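/- **Setting.** Let $n\ge 0$, let $d_1,\dots,d_n\ge 1$ be integers, and let $\mathcal H_{\mathbf d}^{\mathbb R}$ be the space of systems $\mathbf f=(f_1,\dots,f_n)$ of real homogeneous polynomials in $n+1$ variables with $\deg f_i=d_i$, normed by $\|\mathbf f\|^2=\sum_i\sum_{|\mathbf a|=d_i}\binom{d_i}{\mathbf a}^{-1}f_{i,\mathbf a}^2$, where $f_i=\sum_{\mathbf a} f_{i,\mathbf a}\mathbf x^{\mathbf a}$ and $\binom{d}{\mathbf a}$ is the multinomial coefficient. For $\mathbf x$ in the unit sphere $S^n\subset\mathbb R^{n+1}$ put $$\mu(\mathbf f,\mathbf x)=\|\mathbf f\|\,\Big\|\big(\mathrm{diag}(d_1^{-1/2},\dots,d_n^{-1/2})\,D\mathbf f(\mathbf x)_{|\mathbf x^\perp}\big)^{-1}\Big\|$$ (operator norm; $\mu=\infty$ if $D\mathbf f(\mathbf x)_{|\mathbf x^\perp}$ is singular), and let $\mathbf F_{\mathbf x}:\mathbf x^\perp\to\mathbb R^n$, $\mathbf F_{\mathbf x}(\mathbf X)=\mathbf f(\mathbf x+\mathbf X)$. For an analytic map $\mathbf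 F$ with $D\mathbf F(\mathbf X)$ invertible let $N(\mathbf F,\mathbf X)=\mathbf X-D\mathbf F(\mathbf X)^{-1}\mathbf F(\mathbf X)$ and $$\beta(\mathbf F,\mathbf X)=\|D\mathbf F(\mathbf X)^{-1}\mathbf F(\mathbf X)\|,\qquad \gamma(\mathbf F,\mathbf X)=\sup_{k\ge2}\Big(\tfrac{\|D\mathbf F(\mathbf X)^{-1}D^k\mathbf F(\mathbf X)\|}{k!}\Big)^{\frac1{k-1}},\qquad \alpha=\beta\gamma .$$ $\mathbf X_0$ is an *approximate zero of the second kind* of $\mathbf F$, associated to a zero $\mathbf X^*$ of $\mathbf F$, if the sequence $\mathbf X_{k+1}=N(\mathbf F,\mathbf X_k)$ is well defined (every $D\mathbf F(\mathbf X_k)$ is invertible), $\|\mathbf X_{k+1}-\mathbf X_k\|\le 2^{-2^k+1}\|\mathbf X_1-\mathbf X_0\|$ for all $k\ge 0$, and $\mathbf X_k\to \mathbf X^*$. Whenever the Newton sequence of $\mathbf F_{\mathbf x}$ started at $\mathbf X_0=0$ is well defined and converges to some $\mathbf X^*$, put $\zeta_{\mathbf x}=\frac{\mathbf x+\mathbf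 X^*}{\|\mathbf x+\mathbf X^*\|}\in S^n$. Let $\alpha_0=\frac{13-3\sqrt{17}}4$, $r_0(\alpha)=\frac{1+\alpha-\sqrt{1-6\alpha+\alpha^2}}{4\alpha}$, and let $\alpha_*$ be the smallest positive root of $\alpha=\alpha_0\,(1-\alpha\, r_0(\alpha))^2$. Let $\rho$ be the angular distance on $S^n$ and $$B_{\mathbf x}=\{\mathbf y\in S^n:\rho(\mathbf x,\mathbf y)\le r_0(\alpha_*)\,\mu(\mathbf f,\mathbf x)\,\|\mathbf f(\mathbf x)\|\}.$$ **Theorem.** Let $\mathbf f\in\mathcal H_{\mathbf d}^{\mathbb R}$ with $\|\mathbf f\|=1$ and let $\mathbf x\in S^n$ be such that $\mu(\mathbf f,\mathbf x)<\infty$ and $$(\max_i d_i)^{3/2}\,\mu(\mathbf f,\mathbf x)^2\,\|\mathbf f(\mathbf x)\|\le\alpha_* .$$ Then: 1. $\alpha(\mathbf F_{\mathbf x},0)\le\alpha_*$. 2. $0$ is an approximate zero of the second kind of $\mathbf F_{\mathbf x}$ (so that $\zeta_{\mathbf x}$ is defined), and $\mathbf f(\zeta_{\mathbf x})=0$. 3.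 $\zeta_{\mathbf x}\in B_{\mathbf x}$. 4. For every $\mathbf z\in B_{\mathbf x}$, the Newton sequence of $\mathbf F_{\mathbf z}$ started at $0$ is well defined and converges, and $\zeta_{\mathbf z}=\zeta_{\mathbf x}$. -/

import Mathlib

noncomputable section

namespace Inclusion

open Filter Topology
open scoped ENNReal

/-! ### Alpha theory -/

section AlphaTheory

variable {E G : Type*} [NormedAddCommGroup E] [NormedSpace ℝ E]
  [NormedAddCommGroup G] [NormedSpace ℝ G]

/-- The Newton operator `N(F, X) = X - DF(X)⁻¹ F(X)`. (When `DF(X)` is not invertible, Mathlib's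
`ContinuousLinearMap.inverse` is `0`; every statement below about Newton iteration asks
separately that the derivatives be invertible.) -/
def newton (F : E → G) (X : E) : E :=
  X - (fderiv ℝ F X).inverse (F X)

/-- The Newton sequence `X₀, N(F, X₀), N(F, N(F, X₀)), …`. -/
def newtonSeq (F : E → G) (X₀ : E) : ℕ → E
  | 0 => X₀
  | k + 1 => newton F (newtonSeq F X₀ k)

/-- All the derivatives met by the Newton iteration started at `X₀` are invertible. -/
def NewtonWellDefined (F : E → G) (X₀ : E) : Prop :=
  ∀ k, (fderiv ℝ F (newtonSeq F X₀ k)).IsInvertible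

/-- The Newton sequence started at `X₀` is well defined and converges. -/
def NewtonConverges (F : E → G) (X₀ : E) : Prop :=
  NewtonWellDefined F X₀ ∧ ∃ X : E, Tendsto (newtonSeq F X₀) atTop (𝓝 X)

/-- `X₀` is an approximate zero of the second kind of the analytic map `F`, associated to the
zero `ζ`. -/
def IsApproxZeroSecondKind (F : E → G) (ζ X₀ : E) : Prop :=
  F ζ = 0 ∧
  NewtonWellDefined F X₀ ∧
  (∀ k, ‖newtonSeq F X₀ (k + 1) - newtonSeq F X₀ k‖ ≤
    (2 : ℝ) ^ (-(2 : ℤ) ^ k + 1) * ‖newtonSeq F X₀ 1 - newtonSeq F X₀ 0‖) ∧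
  Tendsto (newtonSeq F X₀) atTop (𝓝 ζ)

open Classical in
/-- Smale's invariant `β(F, X) = ‖DF(X)⁻¹ F(X)‖` (`∞` if `DF(X)` is not invertible). -/
def betaInv (F : E → G) (X : E) : ℝ≥0∞ :=
  if (fderiv ℝ F X).IsInvertible then
    ENNReal.ofReal ‖(fderiv ℝ F X).inverse (F X)‖
  else ⊤

open Classical in
/-- Smale's invariant `γ(F, X) = sup_{k ≥ 2} (‖DF(X)⁻¹ DᵏF(X)‖ / k!) ^ (1 / (k - 1))`, with the
operator norm of multilinear maps (`∞` if `DF(X)` is not invertible). -/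
def gammaInv (F : E → G) (X : E) : ℝ≥0∞ :=
  if (fderiv ℝ F X).IsInvertible then
    ⨆ (k : ℕ) (_ : 2 ≤ k),
      ENNReal.ofReal
        ((‖(fderiv ℝ F X).inverse.compContinuousMultilinearMap (iteratedFDeriv ℝ k F X)‖
          / (k.factorial : ℝ)) ^ (1 / ((k : ℝ) - 1)))
  else ⊤

/-- Smale's invariant `α = β γ`. -/
def alphaInv (F : E → G) (X : E) : ℝ≥0∞ :=
  betaInv F X * gammaInv F X

end AlphaTheory

/-- `α₀ = (13 - 3 √17) / 4`. -/
def alphaZero : ℝ := (13 - 3 * √17) / 4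

/-- `r₀(α) = (1 + α - √(1 - 6 α + α²)) / (4 α)`. -/
def rZero (α : ℝ) : ℝ := (1 + α - √(1 - 6 * α + α ^ 2)) / (4 * α)

/-- The positive roots of `α = α₀ (1 - α r₀(α))²` at which `r₀(α)` is a real number. -/
def alphaStarRoots : Set ℝ :=
  {α | 0 < α ∧ 0 ≤ 1 - 6 * α + α ^ 2 ∧ α = alphaZero * (1 - α * rZero α) ^ 2}

/-- `α_*`, the smallest positive root of `α = α₀ (1 - α r₀(α))²`; see `isLeast_alphaStar`. -/
def alphaStar : ℝ := sInf alphaStarRoots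

theorem alphaZero_pos : 0 < alphaZero := by
  have h : √17 < 13 / 3 := by
    rw [Real.sqrt_lt' (by norm_num)]; norm_num
  unfold alphaZero; linarith

theorem alphaZero_lt : alphaZero < 4 / 25 := by
  have h : (309 : ℝ) / 75 < √17 := by
    rw [Real.lt_sqrt (by norm_num)]; norm_num
  unfold alphaZero; linarith

/-- The minimum in the definition of `α_*` is attained. -/
theorem isLeast_alphaStar : IsLeast alphaStarRoots alphaStar := by
  set H : ℝ → ℝ := fun α =>
    α - alphaZero * (1 - (1 + α - √(1 - 6 * α + α ^ 2)) / 4) ^ 2 with hH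
  have hHc : Continuous H := by
    have h1 : Continuous fun α : ℝ => √(1 - 6 * α + α ^ 2) :=
      Real.continuous_sqrt.comp (by fun_prop)
    simp only [hH]; fun_prop
  have hpos := alphaZero_pos
  have hlt := alphaZero_lt
  have hH0 : H 0 = -alphaZero := by simp [hH]
  have hset : alphaStarRoots = {α | 0 ≤ α ∧ 0 ≤ 1 - 6 * α + α ^ 2 ∧ H α = 0} := by
    ext α
    simp only [alphaStarRoots, Set.mem_ofPred_eq]
    constructor
    · rintro ⟨h0, h1, h2⟩
      refine ⟨h0.le, h1, ?_⟩
      have : α * rZero α = (1 + α - √(1 - 6 * α + α ^ 2)) / 4 := by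
        unfold rZero; field_simp
      rw [this] at h2
      simp only [hH]; linarith
    · rintro ⟨h0, h1, h2⟩
      have hne : α ≠ 0 := by
        rintro rfl; rw [hH0] at h2; linarith
      refine ⟨lt_of_le_of_ne h0 (Ne.symm hne), h1, ?_⟩
      have : α * rZero α = (1 + α - √(1 - 6 * α + α ^ 2)) / 4 := by
        unfold rZero; field_simp
      rw [this]
      simp only [hH] at h2; linarith
  have hclosed : IsClosed alphaStarRoots := by
    rw [hset]
    have c1 : IsClosed {α : ℝ | 0 ≤ α} := isClosed_le continuous_const continuous_id
    have c2 : IsClosed {α : ℝ | 0 ≤ 1 - 6 * α + α ^ 2} :=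
      isClosed_le continuous_const (by fun_prop)
    have c3 : IsClosed {α : ℝ | H α = 0} := isClosed_eq hHc continuous_const
    exact c1.inter (c2.inter c3)
  have hH1 : 0 ≤ H alphaZero := by
    have hs1 : √(1 - 6 * alphaZero + alphaZero ^ 2) ≤ 1 + alphaZero := by
      rw [Real.sqrt_le_left (by linarith)]; nlinarith
    have hs0 := Real.sqrt_nonneg (1 - 6 * alphaZero + alphaZero ^ 2)
    have hsq : (1 - (1 + alphaZero - √(1 - 6 * alphaZero + alphaZero ^ 2)) / 4) ^ 2 ≤ 1 := by
      rw [sq_le_one_iff_abs_le_one, abs_le]; constructor <;> linarith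
    simp only [hH]; nlinarith
  have hne : alphaStarRoots.Nonempty := by
    obtain ⟨a, ⟨ha0, ha1⟩, ha⟩ := intermediate_value_Icc hpos.le hHc.continuousOn
      (show (0 : ℝ) ∈ Set.Icc (H 0) (H alphaZero) from ⟨by rw [hH0]; linarith, hH1⟩)
    refine ⟨a, ?_⟩
    rw [hset]
    exact ⟨ha0, by nlinarith, ha⟩
  have hbdd : BddBelow alphaStarRoots := ⟨0, fun a ha => ha.1.le⟩
  exact ⟨hclosed.csInf_mem hne hbdd, fun a ha => csInf_le hbdd ha⟩

/-! ### Real homogeneous polynomial systems -/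

variable {n : ℕ} {d : Fin n → ℕ}

/-- Systems `f = (f₁, …, fₙ)` of real homogeneous polynomials in `n + 1` variables, of degrees
`d = (d₁, …, dₙ)`. -/
abbrev HomogSystem (d : Fin n → ℕ) : Type :=
  (i : Fin n) → MvPolynomial.homogeneousSubmodule (Fin (n + 1)) ℝ (d i)

/-- The orthogonally invariant inner product `⟨f, g⟩ = ∑ₐ f_a g_a / (multinomial coefficient of a)`
of two homogeneous polynomials of the same degree. -/
def weylInner (f g : MvPolynomial (Fin (n + 1)) ℝ) : ℝ :=
  ∑ a ∈ f.support, f.coeff a * g.coeff a / (a.multinomial : ℝ)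

/-- The norm of a homogeneous system, `‖f‖² = ∑ᵢ ⟨fᵢ, fᵢ⟩`. -/
def systemNorm (f : HomogSystem d) : ℝ :=
  √(∑ i, weylInner (f i).1 (f i).1)

/-- The map `f : ℝⁿ⁺¹ → ℝⁿ` defined by a system. -/
def evalSystem (f : HomogSystem d) (y : EuclideanSpace ℝ (Fin (n + 1))) :
    EuclideanSpace ℝ (Fin n) :=
  WithLp.toLp 2 fun i => MvPolynomial.eval (fun j => y j) (f i).1

/-- The orthogonal complement `x^⊥` of the line through `x`. -/
abbrev perp (x : EuclideanSpace ℝ (Fin (n + 1))) :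
    Submodule ℝ (EuclideanSpace ℝ (Fin (n + 1))) :=
  (Submodule.span ℝ {x})ᗮ

/-- The affine restriction `F_x : x^⊥ → ℝⁿ`, `F_x(X) = f(x + X)`. -/
def affineRestriction (f : HomogSystem d) (x : EuclideanSpace ℝ (Fin (n + 1))) :
    perp x → EuclideanSpace ℝ (Fin n) :=
  fun X => evalSystem f (x + (X : EuclideanSpace ℝ (Fin (n + 1))))

/-- The linear map `diag(dᵢ^(-1/2) ‖x‖^(-dᵢ+1)) ∘ Df(x)|_{x^⊥}` from `x^⊥` to `ℝⁿ`. -/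
def scaledDeriv (f : HomogSystem d) (x : EuclideanSpace ℝ (Fin (n + 1))) :
    perp x →L[ℝ] EuclideanSpace ℝ (Fin n) :=
  (Matrix.toEuclideanCLM (𝕜 := ℝ) (Matrix.diagonal fun i =>
      (d i : ℝ) ^ (-(1 / 2) : ℝ) * ‖x‖ ^ (-(d i : ℤ) + 1))).comp
    ((fderiv ℝ (evalSystem f) x).comp (perp x).subtypeL)

open Classical in
/-- The normalized condition number `μ(f, x)`: `‖f‖` times the operator norm of the inverse of
`scaledDeriv f x`, and `∞` if that map is singular. -/
def condNumber (f : HomogSystem d) (x : EuclideanSpace ℝ (Fin (n + 1))) : ℝ≥0∞ :=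
  if (scaledDeriv f x).IsInvertible then
    ENNReal.ofReal (systemNorm f * ‖(scaledDeriv f x).inverse‖)
  else ⊤

/-- `max dᵢ`. -/
def maxDegree (d : Fin n → ℕ) : ℕ := Finset.univ.sup d

/-- `ζ_x = (x + X*) / ‖x + X*‖`, where `X*` is the limit of the Newton sequence of `F_x` started
at `0`. It is meaningful only when that sequence is well defined and converges, that is, under
`NewtonConverges (affineRestriction f x) 0`. -/
def zeta (f : HomogSystem d) (x : EuclideanSpace ℝ (Fin (n + 1))) :
    EuclideanSpace ℝ (Fin (n + 1)) :=
  let X : perp x := limUnder atTop (newtonSeq (affineRestriction f x) 0)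
  ‖x + (X : EuclideanSpace ℝ (Fin (n + 1)))‖⁻¹ • (x + (X : EuclideanSpace ℝ (Fin (n + 1))))

/-- The closed spherical ball `B_x`: the unit vectors at angular distance at most
`r₀(α_*) μ(f, x) ‖f(x)‖` from `x`. -/
def inclusionBall (f : HomogSystem d) (x : EuclideanSpace ℝ (Fin (n + 1))) :
    Set (EuclideanSpace ℝ (Fin (n + 1))) :=
  {y | ‖y‖ = 1 ∧ ENNReal.ofReal (InnerProductGeometry.angle x y) ≤
    ENNReal.ofReal (rZero alphaStar) * condNumber f x * ENNReal.ofReal ‖evalSystem f x‖}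

end Inclusion

end

/-!
The systems are studied through `g = diag(dᵢ^(-1/2)) f`, whose Newton sequences in the charts are
those of `f`. Everything rests on three ingredients.

*Derivative bounds.* A homogeneous polynomial `p` of degree `m` is the diagonal of a symmetric
`m`-linear form (`polarForm`) whose Hilbert–Schmidt norm is the orthogonally invariant norm of `p`
(`norm_polarForm_le`). Hence, for `‖f‖ = 1` and `D = max dᵢ`, the `k`-th derivative of `g` at a unit
vector is at most `D^(k - 1/2)`, and `Dg` is Lipschitz, with constant `D^(3/2)` on the unit ball and
with a slightly larger one on small balls of the affine charts
(`norm_fderiv_degScale_affineRestriction_sub_le`). The case `k = 1` gives `D^(1/2) μ ≥ 1`, which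
turns the bounds for `k ≥ 2` into `γ(F_x, 0) ≤ D^(3/2) μ`. As `β(F_x, 0) ≤ b := μ ‖f(x)‖`, this is
the bound for `α(F_x, 0)`.

*Newton's method.* Since `D^(3/2) μ b ≤ α_* ≤ 1/8`, the Newton–Kantorovich theorem
(`newton_kantorovich`), with the Lipschitz constant above, applies to `F_x` at `0`: the sequence
converges quadratically to a zero at distance at most `9/8 b`, and `9/8 ≤ r₀(α_*)`. Therefore
`ζ_x` lies in `B_x`.

*Changing the chart.* At the zero `ζ = ζ_x`, Euler's identity says that `Df(ζ)` kills `ζ`. The lower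
bound `1/μ` for the normalized derivative on `x^⊥` passes from `x` to `ζ` at the cost of
`D^(3/2) ρ(x, ζ)`, and then from `x^⊥` to `z^⊥` at the cost of a factor `⟨z, ζ⟩`
(`lower_bound_change_chart`). For `z` in `B_x` the chart at `z` contains the point of the ray
through `ζ` at distance at most `5/2 b` from its origin, because `r₀(α_*) ≤ 5/4`. This is
close enough for Newton's method to converge to that point (`newton_tendsto_of_zero`), that is,
for `ζ_z = ζ`.
-/

namespace Inclusion

open Filter Topology

/-! ### The symmetric tensor of a homogeneous polynomial -/

section Tensor

variable {σ : Type*}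

/-- The exponent vector of the monomial `X_{J 0} ⋯ X_{J (m - 1)}`. -/
noncomputable def wordExponent {m : ℕ} (J : Fin m → σ) : σ →₀ ℕ :=
  ∑ l, Finsupp.single (J l) 1

lemma prod_X_eq_monomial_wordExponent {m : ℕ} (J : Fin m → σ) :
    ∏ l, (MvPolynomial.X (J l) : MvPolynomial σ ℕ) =
      MvPolynomial.monomial (wordExponent J) 1 := by
  simp only [wordExponent, MvPolynomial.X]
  rw [MvPolynomial.monomial_sum_one]

lemma finsupp_multinomial_eq_univ [Fintype σ] (a : σ →₀ ℕ) :
    a.multinomial = Nat.multinomial Finset.univ a := by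
  rw [Finsupp.multinomial, Nat.multinomial, Finsupp.sum_fintype _ _ (by simp),
    Finsupp.prod_fintype _ _ (by simp)]
  simp

/-- The fibres of `wordExponent` are counted by multinomial coefficients: compare the coefficients
of the two expansions of `(∑ Xᵢ) ^ m`. -/
lemma card_wordExponent_eq [Fintype σ] [DecidableEq σ] {m : ℕ} (a : σ →₀ ℕ) (ha : a.degree = m) :
    (Finset.univ.filter fun J : Fin m → σ => wordExponent J = a).card = a.multinomial := by
  have h1 : (∑ i, (MvPolynomial.X i : MvPolynomial σ ℕ)) ^ m =
      ∑ J : Fin m → σ, MvPolynomial.monomial (wordExponent J) 1 := by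
    rw [Fintype.sum_pow]
    exact Finset.sum_congr rfl fun J _ => prod_X_eq_monomial_wordExponent J
  have h2 := Finset.sum_pow_eq_sum_piAntidiag Finset.univ
    (fun i => (MvPolynomial.X i : MvPolynomial σ ℕ)) m
  rw [h1] at h2
  have h3 := congrArg (MvPolynomial.coeff a) h2
  simp only [MvPolynomial.coeff_sum, MvPolynomial.coeff_monomial] at h3
  rw [Finset.card_filter, h3, finsupp_multinomial_eq_univ]
  have h4 : ∀ k : σ → ℕ, MvPolynomial.coeff a
      (((Nat.multinomial Finset.univ k : ℕ) : MvPolynomial σ ℕ) *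
        ∏ i, (MvPolynomial.X i : MvPolynomial σ ℕ) ^ k i) =
      if k = a then Nat.multinomial Finset.univ k else 0 := by
    intro k
    have h5 : ∏ i, (MvPolynomial.X i : MvPolynomial σ ℕ) ^ k i =
        MvPolynomial.monomial (Finsupp.equivFunOnFinite.symm k) 1 := by
      rw [MvPolynomial.monomial_eq, Finsupp.prod_fintype _ _ (by simp)]
      simp
    have h6 : ((Nat.multinomial Finset.univ k : ℕ) : MvPolynomial σ ℕ) =
        MvPolynomial.C (Nat.multinomial Finset.univ k) := by simp
    rw [h5, h6, MvPolynomial.coeff_C_mul, MvPolynomial.coeff_monomial]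
    have : Finsupp.equivFunOnFinite.symm k = a ↔ k = a := by
      rw [Equiv.symm_apply_eq]; rfl
    simp [this]
  rw [Finset.sum_congr rfl fun k _ => h4 k, Finset.sum_ite_eq' , if_pos]
  rw [Finset.mem_piAntidiag]
  refine ⟨?_, by simp⟩
  rw [← ha, Finsupp.degree_eq_sum]

/-- Summing over words of length `m` a function of their exponent vectors. -/
lemma sum_wordExponent [Fintype σ] [DecidableEq σ] {m : ℕ} (φ : (σ →₀ ℕ) → ℝ) (s : Finset (σ →₀ ℕ))
    (hs : ∀ a ∈ s, a.degree = m) (hφ : ∀ a ∉ s, φ a = 0) :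
    ∑ J : Fin m → σ, φ (wordExponent J) = ∑ a ∈ s, (a.multinomial : ℝ) * φ a := by
  have h1 : ∀ J : Fin m → σ, φ (wordExponent J) =
      ∑ a ∈ s, if wordExponent J = a then φ a else 0 := by
    intro J
    rw [Finset.sum_ite_eq]
    split_ifs with h
    · rfl
    · exact hφ _ h
  rw [Finset.sum_congr rfl fun J _ => h1 J, Finset.sum_comm]
  refine Finset.sum_congr rfl fun a ha => ?_
  rw [← card_wordExponent_eq a (hs a ha), ← Finset.sum_filter, Finset.sum_const, nsmul_eq_mul]

lemma multinomial_pos (a : σ →₀ ℕ) : (0 : ℝ) < a.multinomial := by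
  rw [Finsupp.multinomial_eq]
  exact_mod_cast Nat.multinomial_pos _ _

/-- The symmetric `m`-linear form `M` with `M(y, …, y) = p(y)`, for a homogeneous polynomial `p` of
degree `m`. Its coordinates are the coefficients of `p` divided by multinomial coefficients. -/
noncomputable def polarForm [Fintype σ] (m : ℕ) (p : MvPolynomial σ ℝ) :
    ContinuousMultilinearMap ℝ (fun _ : Fin m => EuclideanSpace ℝ σ) ℝ :=
  ∑ J : Fin m → σ, (p.coeff (wordExponent J) / (wordExponent J).multinomial) •
    (ContinuousMultilinearMap.mkPiAlgebra ℝ (Fin m) ℝ).compContinuousLinearMap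
      fun l => EuclideanSpace.proj (J l)

lemma polarForm_apply [Fintype σ] (m : ℕ) (p : MvPolynomial σ ℝ) (v : Fin m → EuclideanSpace ℝ σ) :
    polarForm m p v = ∑ J : Fin m → σ,
      (p.coeff (wordExponent J) / (wordExponent J).multinomial) * ∏ l, v l (J l) := by
  simp [polarForm]

lemma degree_of_mem_support {m : ℕ} {p : MvPolynomial σ ℝ} (hp : p.IsHomogeneous m)
    {a : σ →₀ ℕ} (ha : a ∈ p.support) : a.degree = m := by
  have := hp (MvPolynomial.mem_support_iff.mp ha)
  rw [Finsupp.degree_eq_weight_one]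
  exact this

lemma polarForm_diagonal [Fintype σ] [DecidableEq σ] {m : ℕ} {p : MvPolynomial σ ℝ}
    (hp : p.IsHomogeneous m) (y : EuclideanSpace ℝ σ) :
    polarForm m p (fun _ => y) = MvPolynomial.eval (fun j => y j) p := by
  rw [polarForm_apply]
  have h1 : ∀ J : Fin m → σ, ∏ l, y (J l) = (wordExponent J).prod fun i e => y i ^ e := by
    intro J
    rw [wordExponent, ← Finsupp.prod_finsetSum_index (by simp) (by intros; rw [pow_add])]
    simp
  simp only [h1]
  rw [sum_wordExponent
    (fun a => p.coeff a / a.multinomial * a.prod fun i e => y i ^ e) p.support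
    (fun a ha => degree_of_mem_support hp ha)
    (fun a ha => by simp [MvPolynomial.notMem_support_iff.mp ha]),
    MvPolynomial.eval_eq]
  refine Finset.sum_congr rfl fun a _ => ?_
  have := (multinomial_pos a).ne'
  rw [Finsupp.prod]
  field_simp

/-- The Cauchy–Schwarz inequality for the Hilbert–Schmidt norm of `polarForm`, which is the
orthogonally invariant norm of `p`. -/
lemma norm_polarForm_le [Fintype σ] [DecidableEq σ] {m : ℕ} {p : MvPolynomial σ ℝ}
    (hp : p.IsHomogeneous m) :
    ‖polarForm m p‖ ≤ √(∑ a ∈ p.support, p.coeff a * p.coeff a / (a.multinomial : ℝ)) := by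
  refine ContinuousMultilinearMap.opNorm_le_bound (Real.sqrt_nonneg _) fun v => ?_
  have h1 : ∑ J : Fin m → σ, (p.coeff (wordExponent J) / (wordExponent J).multinomial) ^ 2 =
      ∑ a ∈ p.support, p.coeff a * p.coeff a / (a.multinomial : ℝ) := by
    rw [sum_wordExponent (fun a => (p.coeff a / a.multinomial) ^ 2) p.support
      (fun a ha => degree_of_mem_support hp ha)
      (fun a ha => by simp [MvPolynomial.notMem_support_iff.mp ha])]
    refine Finset.sum_congr rfl fun a _ => ?_
    have := (multinomial_pos a).ne'
    field_simp
  have h2 : ∑ J : Fin m → σ, (∏ l, v l (J l)) ^ 2 = (∏ l, ‖v l‖) ^ 2 := by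
    simp_rw [← Finset.prod_pow, EuclideanSpace.real_norm_sq_eq]
    rw [Finset.prod_univ_sum]
    simp
  rw [polarForm_apply, Real.norm_eq_abs]
  refine abs_le_of_sq_le_sq ?_ (by positivity)
  refine (Finset.sum_mul_sq_le_sq_mul_sq _ _ _).trans ?_
  rw [h1, h2, mul_pow, Real.sq_sqrt]
  exact Finset.sum_nonneg fun a _ =>
    div_nonneg (mul_self_nonneg _) (multinomial_pos a).le

lemma contDiff_eval [Fintype σ] [DecidableEq σ] {m : ℕ} {p : MvPolynomial σ ℝ}
    (hp : p.IsHomogeneous m) (N : WithTop ℕ∞) :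
    ContDiff ℝ N fun y : EuclideanSpace ℝ σ => MvPolynomial.eval (fun j => y j) p := by
  simp_rw [← polarForm_diagonal hp]
  exact (polarForm m p).contDiff.comp (contDiff_pi.mpr fun _ => contDiff_id)

/-- The derivatives of a homogeneous polynomial are controlled by its orthogonally invariant
norm. -/
lemma norm_iteratedFDeriv_eval_le [Fintype σ] [DecidableEq σ] {m : ℕ} {p : MvPolynomial σ ℝ}
    (hp : p.IsHomogeneous m) (k : ℕ) (w : EuclideanSpace ℝ σ) :
    ‖iteratedFDeriv ℝ k (fun y : EuclideanSpace ℝ σ => MvPolynomial.eval (fun j => y j) p) w‖ ≤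
      m.descFactorial k * √(∑ a ∈ p.support, p.coeff a * p.coeff a / (a.multinomial : ℝ)) *
        ‖w‖ ^ (m - k) := by
  set diag : EuclideanSpace ℝ σ →L[ℝ] (Fin m → EuclideanSpace ℝ σ) :=
    ContinuousLinearMap.pi fun _ => ContinuousLinearMap.id ℝ _ with hdiag
  have h1 : (fun y : EuclideanSpace ℝ σ => MvPolynomial.eval (fun j => y j) p) =
      polarForm m p ∘ diag := by
    ext y; exact (polarForm_diagonal hp y).symm
  have hd : ‖diag‖ ≤ 1 := by
    refine ContinuousLinearMap.opNorm_le_bound _ zero_le_one fun y => ?_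
    rw [one_mul]
    exact (pi_norm_le_iff_of_nonneg (norm_nonneg y)).mpr fun _ => le_rfl
  rw [h1, diag.iteratedFDeriv_comp_right (polarForm m p).contDiff w (i := k) (n := ⊤)
    (by exact_mod_cast le_top)]
  refine (ContinuousMultilinearMap.norm_compContinuousLinearMap_le _ _).trans ?_
  have h2 : ∏ _i : Fin k, ‖diag‖ ≤ 1 :=
    Finset.prod_le_one (fun _ _ => norm_nonneg _) fun _ _ => hd
  refine (mul_le_of_le_one_right (norm_nonneg _) h2).trans ?_
  refine ((polarForm m p).norm_iteratedFDeriv_le k (diag w)).trans ?_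
  rw [Fintype.card_fin]
  have h3 : ‖diag w‖ ≤ ‖w‖ := (diag.le_of_opNorm_le hd w).trans (by rw [one_mul])
  gcongr
  exact norm_polarForm_le hp

end Tensor

/-! ### Newton iteration under a Lipschitz condition on the derivative -/

section Newton

variable {E G G' : Type*} [NormedAddCommGroup E] [NormedSpace ℝ E]
  [NormedAddCommGroup G] [NormedSpace ℝ G] [NormedAddCommGroup G'] [NormedSpace ℝ G']

lemma isInvertible_of_lower_bound [FiniteDimensional ℝ E] [FiniteDimensional ℝ G]
    (hEG : Module.finrank ℝ E = Module.finrank ℝ G) {T : E →L[ℝ] G} {m : ℝ} (hm : 0 < m)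
    (hT : ∀ v, m * ‖v‖ ≤ ‖T v‖) : T.IsInvertible := by
  have hinj : Function.Injective T := by
    rw [injective_iff_map_eq_zero]
    intro v hv
    have := hT v
    rw [hv, norm_zero] at this
    exact norm_le_zero_iff.mp (nonpos_of_mul_nonpos_right this hm)
  refine ⟨(LinearEquiv.ofInjectiveOfFinrankEq T.toLinearMap hinj hEG).toContinuousLinearEquiv, ?_⟩
  ext v
  rfl

lemma norm_inverse_apply_le {T : E →L[ℝ] G} (hI : T.IsInvertible) {m : ℝ} (hm : 0 < m)
    (hT : ∀ v, m * ‖v‖ ≤ ‖T v‖) (y : G) : ‖T.inverse y‖ ≤ ‖y‖ / m := by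
  rw [le_div_iff₀ hm, mul_comm]
  simpa [hI.self_apply_inverse] using hT (T.inverse y)

/-- First order Taylor estimate for a map whose derivative satisfies a Lipschitz condition. -/
lemma norm_taylor_le {F : E → G} (hF : Differentiable ℝ F) {s : Set E} (hs : Convex ℝ s) {L : ℝ}
    (hL : ∀ X ∈ s, ∀ Y ∈ s, ‖fderiv ℝ F Y - fderiv ℝ F X‖ ≤ L * ‖Y - X‖) {X Y : E} (hX : X ∈ s)
    (hY : Y ∈ s) :
    ‖F Y - F X - fderiv ℝ F X (Y - X)‖ ≤ L / 2 * ‖Y - X‖ ^ 2 := by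
  have hd : ∀ t : ℝ, HasDerivAt (fun t : ℝ => F (X + t • (Y - X)) - F X - t • fderiv ℝ F X (Y - X))
      (fderiv ℝ F (X + t • (Y - X)) (Y - X) - fderiv ℝ F X (Y - X)) t := by
    intro t
    have h1 : HasDerivAt (fun t : ℝ => X + t • (Y - X)) (Y - X) t := by
      simpa using ((hasDerivAt_id t).smul_const (Y - X)).const_add X
    have h2 := (hF (X + t • (Y - X))).hasFDerivAt.comp_hasDerivAt t h1
    have h3 : HasDerivAt (fun t : ℝ => t • fderiv ℝ F X (Y - X)) (fderiv ℝ F X (Y - X)) t := by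
      simpa using (hasDerivAt_id t).smul_const (fderiv ℝ F X (Y - X))
    exact (h2.sub_const _).sub h3
  have hB : ∀ t : ℝ, HasDerivAt (fun t : ℝ => L * ‖Y - X‖ ^ 2 * (t ^ 2 / 2))
      (L * ‖Y - X‖ ^ 2 * t) t := by
    intro t
    have := (((hasDerivAt_id t).pow 2).div_const 2).const_mul (L * ‖Y - X‖ ^ 2)
    simpa using this
  have key := image_norm_le_of_norm_deriv_right_le_deriv_boundary (a := 0) (b := 1)
    (fun t _ => (hd t).continuousAt.continuousWithinAt)
    (fun t _ => (hd t).hasDerivWithinAt) (B := fun t => L * ‖Y - X‖ ^ 2 * (t ^ 2 / 2))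
    (by simp) hB ?_ (Set.right_mem_Icc.mpr zero_le_one)
  · simp only [one_smul, add_sub_cancel] at key
    linarith
  · intro t ht
    have hmem : X + t • (Y - X) ∈ s := hs.add_smul_sub_mem hX hY ⟨ht.1, ht.2.le⟩
    rw [← sub_apply]
    refine (ContinuousLinearMap.le_opNorm _ _).trans ?_
    have := hL X hX _ hmem
    rw [add_sub_cancel_left, norm_smul, Real.norm_of_nonneg ht.1] at this
    calc _ ≤ L * (t * ‖Y - X‖) * ‖Y - X‖ := by gcongr
      _ = _ := by ring

lemma lower_bound_of_norm_sub_le {T T' : E →L[ℝ] G} {m ε : ℝ} (hT : ∀ v, m * ‖v‖ ≤ ‖T v‖)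
    (h : ‖T' - T‖ ≤ ε) (v : E) : (m - ε) * ‖v‖ ≤ ‖T' v‖ := by
  have h1 : ‖(T' - T) v‖ ≤ ε * ‖v‖ := ContinuousLinearMap.le_of_opNorm_le _ h v
  have h2 : ‖T v‖ ≤ ‖T' v‖ + ‖(T' - T) v‖ := by
    have : T v = T' v - (T' - T) v := by simp
    rw [this]; exact norm_sub_le _ _
  have := hT v
  linarith

lemma fderiv_newton_sub {F : E → G} {X : E} (h : (fderiv ℝ F X).IsInvertible) :
    fderiv ℝ F X (newton F X - X) = -F X := by
  rw [newton, sub_sub_cancel_left, map_neg, h.self_apply_inverse]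

/-- A Newton–Kantorovich theorem: if `DF` is bounded below by `m` at `X₀` and `L`-Lipschitz on the
ball of radius `R` around `X₀`, then, for a first step `b` that is small enough, the Newton steps
decrease like `q ^ (2 ^ k - 1) b`, where `L b / (2 (m - L R)) ≤ q ≤ 1 / 2`, and stay in the ball if
`b / (1 - q) ≤ R`. -/
theorem newton_kantorovich [FiniteDimensional ℝ E] [FiniteDimensional ℝ G]
    (hEG : Module.finrank ℝ E = Module.finrank ℝ G) {F : E → G} (hF : Differentiable ℝ F) {X₀ : E}
    {m L R q : ℝ} (hL0 : 0 ≤ L) (hR0 : 0 ≤ R)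
    (hm : ∀ v, m * ‖v‖ ≤ ‖fderiv ℝ F X₀ v‖)
    (hL : ∀ X ∈ Metric.closedBall X₀ R, ∀ Y ∈ Metric.closedBall X₀ R,
      ‖fderiv ℝ F Y - fderiv ℝ F X‖ ≤ L * ‖Y - X‖)
    (hLR : L * R < m) (hq : L * ‖newton F X₀ - X₀‖ / (2 * (m - L * R)) ≤ q) (hq2 : q ≤ 1 / 2)
    (hsum : ‖newton F X₀ - X₀‖ / (1 - q) ≤ R) :
    ∃ X, IsApproxZeroSecondKind F X X₀ ∧ ‖X - X₀‖ ≤ R := by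
  set b := ‖newton F X₀ - X₀‖ with hb
  have hb0 : 0 ≤ b := norm_nonneg _
  have hmR : 0 < m - L * R := sub_pos.mpr hLR
  have hq0 : 0 ≤ q := le_trans (by positivity) hq
  have hq1 : q < 1 := by linarith
  have hlow : ∀ X ∈ Metric.closedBall X₀ R, ∀ v, (m - L * R) * ‖v‖ ≤ ‖fderiv ℝ F X v‖ := by
    intro X hX v
    refine lower_bound_of_norm_sub_le hm ((hL X₀ (Metric.mem_closedBall_self hR0) X hX).trans ?_) v
    gcongr
    exact mem_closedBall_iff_norm.mp hX
  have hinv : ∀ X ∈ Metric.closedBall X₀ R, (fderiv ℝ F X).IsInvertible := fun X hX =>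
    isInvertible_of_lower_bound hEG hmR (hlow X hX)
  set x := newtonSeq F X₀ with hx
  -- the partial sums of the geometric series `∑ b q ^ j` stay below `R`
  have hgeom : ∀ k, b * ∑ j ∈ Finset.range k, q ^ j ≤ R := by
    intro k
    refine le_trans ?_ hsum
    rw [div_eq_mul_inv, ← tsum_geometric_of_lt_one hq0 hq1]
    gcongr
    exact (summable_geometric_of_lt_one hq0 hq1).sum_le_tsum _ fun _ _ => by positivity
  -- a Newton step between two points of the ball makes the residual quadratically small
  have hres : ∀ k, x k ∈ Metric.closedBall X₀ R → x (k + 1) ∈ Metric.closedBall X₀ R →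
      ‖F (x (k + 1))‖ ≤ L / 2 * ‖x (k + 1) - x k‖ ^ 2 := by
    intro k h1 h2
    have := norm_taylor_le hF (convex_closedBall X₀ R) hL h1 h2
    rwa [show x (k + 1) - x k = newton F (x k) - x k from rfl, fderiv_newton_sub (hinv _ h1),
      sub_neg_eq_add, sub_add_cancel] at this
  have hpow : ∀ k : ℕ, q ^ (2 ^ k - 1) ≤ q ^ k := fun k =>
    pow_le_pow_of_le_one hq0 hq1.le (Nat.le_sub_one_of_lt Nat.lt_two_pow_self)
  have main : ∀ k, ‖x k - X₀‖ ≤ b * ∑ j ∈ Finset.range k, q ^ j ∧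
      ‖x (k + 1) - x k‖ ≤ q ^ (2 ^ k - 1) * b := by
    intro k
    induction k with
    | zero => exact ⟨by simp [hx, newtonSeq], by simp [hx, newtonSeq, hb]⟩
    | succ k ih =>
      obtain ⟨h1, h2⟩ := ih
      have h3 : ‖x (k + 1) - X₀‖ ≤ b * ∑ j ∈ Finset.range (k + 1), q ^ j := by
        rw [Finset.sum_range_succ, mul_add]
        have : x (k + 1) - X₀ = (x k - X₀) + (x (k + 1) - x k) := by abel
        rw [this]
        refine (norm_add_le _ _).trans (add_le_add h1 (h2.trans ?_))
        rw [mul_comm b]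
        exact mul_le_mul_of_nonneg_right (hpow k) hb0
      have m1 : x k ∈ Metric.closedBall X₀ R := mem_closedBall_iff_norm.mpr (h1.trans (hgeom k))
      have m2 : x (k + 1) ∈ Metric.closedBall X₀ R :=
        mem_closedBall_iff_norm.mpr (h3.trans (hgeom _))
      refine ⟨h3, ?_⟩
      have h4 : ‖x (k + 1 + 1) - x (k + 1)‖ ≤ ‖F (x (k + 1))‖ / (m - L * R) := by
        have : x (k + 1 + 1) - x (k + 1) = -(fderiv ℝ F (x (k + 1))).inverse (F (x (k + 1))) := by
          change newton F (x (k + 1)) - x (k + 1) = _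
          rw [newton, sub_sub_cancel_left]
        rw [this, norm_neg]
        exact norm_inverse_apply_le (hinv _ m2) hmR (hlow _ m2) _
      have hexp : 2 ^ (k + 1) - 1 = 1 + 2 * (2 ^ k - 1) := by
        have : 1 ≤ 2 ^ k := Nat.one_le_two_pow
        rw [pow_succ]; omega
      calc ‖x (k + 1 + 1) - x (k + 1)‖ ≤ ‖F (x (k + 1))‖ / (m - L * R) := h4
        _ ≤ (L / 2 * ‖x (k + 1) - x k‖ ^ 2) / (m - L * R) := by gcongr; exact hres k m1 m2
        _ ≤ (L / 2 * (q ^ (2 ^ k - 1) * b) ^ 2) / (m - L * R) := by gcongr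
        _ = (L * b / (2 * (m - L * R))) * (q ^ (2 * (2 ^ k - 1)) * b) := by
          rw [mul_pow, ← pow_mul, mul_comm (2 ^ k - 1) 2]; field_simp
        _ ≤ q * (q ^ (2 * (2 ^ k - 1)) * b) := by gcongr
        _ = q ^ (2 ^ (k + 1) - 1) * b := by rw [hexp, pow_add, pow_one]; ring
  have hmem : ∀ k, x k ∈ Metric.closedBall X₀ R := fun k =>
    mem_closedBall_iff_norm.mpr ((main k).1.trans (hgeom k))
  have hdist : ∀ k, dist (x k) (x (k + 1)) ≤ b * q ^ k := by
    intro k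
    rw [dist_comm, dist_eq_norm, mul_comm]
    exact (main k).2.trans (mul_le_mul_of_nonneg_right (hpow k) hb0)
  have : CompleteSpace E := FiniteDimensional.complete ℝ E
  obtain ⟨X, hX⟩ := cauchySeq_tendsto_of_complete (cauchySeq_of_le_geometric q b hq1 hdist)
  have hzero : F X = 0 := by
    have h1 : Tendsto (fun k => F (x (k + 1))) atTop (𝓝 (F X)) :=
      (hF.continuous.tendsto X).comp (hX.comp (tendsto_add_atTop_nat 1))
    refine tendsto_nhds_unique h1 ?_
    have h2 : Tendsto (fun k => L / 2 * ‖x (k + 1) - x k‖ ^ 2) atTop (𝓝 0) := by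
      have := (((hX.comp (tendsto_add_atTop_nat 1)).sub hX).norm.pow 2).const_mul (L / 2)
      simpa using this
    exact squeeze_zero_norm (fun k => hres k (hmem k) (hmem _)) h2
  refine ⟨X, ⟨hzero, fun k => hinv _ (hmem k), fun k => ?_, hX⟩, ?_⟩
  · refine (main k).2.trans ?_
    change _ ≤ _ * b
    gcongr
    calc q ^ (2 ^ k - 1) ≤ (1 / 2 : ℝ) ^ (2 ^ k - 1) := by gcongr
      _ = (2 : ℝ) ^ (-(2 : ℤ) ^ k + 1) := by
        rw [one_div, ← zpow_natCast, inv_zpow', Nat.cast_sub Nat.one_le_two_pow]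
        congr 1
        push_cast
        ring
  · have := dist_le_of_le_geometric_of_tendsto₀ q b hq1 hdist hX
    rw [dist_comm, dist_eq_norm] at this
    exact this.trans hsum

/-- Local convergence of Newton's method: started at distance `r` from a zero `X` at which `DF` is
bounded below by `m`, it converges to `X` as soon as `L r / m < 2 / 3`, for a Lipschitz constant
`L` of `DF` on the ball of radius `r` around `X`. -/
theorem newton_tendsto_of_zero [FiniteDimensional ℝ E] [FiniteDimensional ℝ G]
    (hEG : Module.finrank ℝ E = Module.finrank ℝ G) {F : E → G} (hF : Differentiable ℝ F) {X X₀ : E}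
    {m L r : ℝ} (hL0 : 0 ≤ L) (hX : F X = 0) (hX₀ : ‖X₀ - X‖ ≤ r)
    (hm : ∀ v, m * ‖v‖ ≤ ‖fderiv ℝ F X v‖)
    (hL : ∀ Y ∈ Metric.closedBall X r, ∀ Z ∈ Metric.closedBall X r,
      ‖fderiv ℝ F Z - fderiv ℝ F Y‖ ≤ L * ‖Z - Y‖)
    (hm0 : 0 < m) (hLr : 3 * (L * r) < 2 * m) :
    NewtonWellDefined F X₀ ∧ Tendsto (newtonSeq F X₀) atTop (𝓝 X) := by
  have hr0 : 0 ≤ r := (norm_nonneg _).trans hX₀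
  have hmr : 0 < m - L * r := by nlinarith
  set κ := L * r / (2 * (m - L * r)) with hκ
  have hκ0 : 0 ≤ κ := by positivity
  have hκ1 : κ < 1 := by rw [hκ, div_lt_one (by positivity)]; linarith
  have hlow : ∀ Y ∈ Metric.closedBall X r, ∀ v, (m - L * r) * ‖v‖ ≤ ‖fderiv ℝ F Y v‖ := by
    intro Y hY v
    refine lower_bound_of_norm_sub_le hm ((hL X (Metric.mem_closedBall_self hr0) Y hY).trans ?_) v
    gcongr
    exact mem_closedBall_iff_norm.mp hY
  have hinv : ∀ Y ∈ Metric.closedBall X r, (fderiv ℝ F Y).IsInvertible := fun Y hY =>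
    isInvertible_of_lower_bound hEG hmr (hlow Y hY)
  have hstep : ∀ Y ∈ Metric.closedBall X r, ‖newton F Y - X‖ ≤ κ * ‖Y - X‖ := by
    intro Y hY
    have h1 := norm_taylor_le hF (convex_closedBall X r) hL hY (Metric.mem_closedBall_self hr0)
    have h2 : newton F Y - X = (fderiv ℝ F Y).inverse (F X - F Y - fderiv ℝ F Y (X - Y)) := by
      rw [newton, map_sub, map_sub, (hinv Y hY).inverse_apply_self, hX, map_zero]
      abel
    rw [h2]
    refine (norm_inverse_apply_le (hinv Y hY) hmr (hlow Y hY) _).trans ?_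
    rw [div_le_iff₀ hmr]
    refine h1.trans ?_
    rw [norm_sub_rev X Y]
    have h3 : ‖Y - X‖ ≤ r := mem_closedBall_iff_norm.mp hY
    calc L / 2 * ‖Y - X‖ ^ 2 ≤ L / 2 * (r * ‖Y - X‖) := by
          rw [sq]; gcongr
      _ = κ * ‖Y - X‖ * (m - L * r) := by rw [hκ]; field_simp
  have main : ∀ k, ‖newtonSeq F X₀ k - X‖ ≤ κ ^ k * r := by
    intro k
    induction k with
    | zero => simpa [newtonSeq] using hX₀
    | succ k ih =>
      have hmem : newtonSeq F X₀ k ∈ Metric.closedBall X r := by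
        rw [mem_closedBall_iff_norm]
        exact ih.trans (mul_le_of_le_one_left hr0 (pow_le_one₀ hκ0 hκ1.le))
      refine (hstep _ hmem).trans ?_
      rw [pow_succ']
      calc κ * ‖newtonSeq F X₀ k - X‖ ≤ κ * (κ ^ k * r) := by gcongr
        _ = _ := by ring
  refine ⟨fun k => hinv _ ?_, ?_⟩
  · rw [mem_closedBall_iff_norm]
    exact (main k).trans (mul_le_of_le_one_left hr0 (pow_le_one₀ hκ0 hκ1.le))
  · rw [tendsto_iff_norm_sub_tendsto_zero]
    refine squeeze_zero (fun _ => norm_nonneg _) main ?_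
    simpa using (tendsto_pow_atTop_nhds_zero_of_lt_one hκ0 hκ1).mul_const r

/-! ### Invariance of Newton iteration under linear changes of the target -/

section LeftComposition

variable {F : E → G} {S : G →L[ℝ] G'}

lemma fderiv_comp_left (hF : Differentiable ℝ F) (X : E) :
    fderiv ℝ (fun Y => S (F Y)) X = S.comp (fderiv ℝ F X) :=
  (S.hasFDerivAt.comp X (hF X).hasFDerivAt).fderiv

lemma isInvertible_comp_left_iff (hS : S.IsInvertible) (T : E →L[ℝ] G) :
    (S.comp T).IsInvertible ↔ T.IsInvertible := by
  obtain ⟨e, rfl⟩ := hS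
  exact ContinuousLinearMap.isInvertible_equiv_comp

lemma newtonSeq_comp_left (hS : S.IsInvertible) (hF : Differentiable ℝ F) (X₀ : E) :
    newtonSeq (fun Y => S (F Y)) X₀ = newtonSeq F X₀ := by
  ext k
  induction k with
  | zero => rfl
  | succ k ih =>
    change newton _ _ = newton _ _
    rw [ih, newton, newton, fderiv_comp_left hF, hS.inverse_comp_apply_of_left,
      hS.inverse_apply_self]

lemma newtonWellDefined_comp_left (hS : S.IsInvertible) (hF : Differentiable ℝ F) {X₀ : E} :
    NewtonWellDefined (fun Y => S (F Y)) X₀ ↔ NewtonWellDefined F X₀ := by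
  simp only [NewtonWellDefined, newtonSeq_comp_left hS hF, fderiv_comp_left hF,
    isInvertible_comp_left_iff hS]

lemma isApproxZeroSecondKind_comp_left (hS : S.IsInvertible) (hF : Differentiable ℝ F) {X X₀ : E} :
    IsApproxZeroSecondKind (fun Y => S (F Y)) X X₀ ↔ IsApproxZeroSecondKind F X X₀ := by
  simp only [IsApproxZeroSecondKind, newtonSeq_comp_left hS hF, newtonWellDefined_comp_left hS hF,
    map_eq_zero_iff S hS.injective]

end LeftComposition

end Newton

/-! ### Homogeneous systems normalized by their degrees -/

section Systems

variable {n : ℕ} {d : Fin n → ℕ}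

/-- The diagonal map `diag(dᵢ^(-1/2))`. -/
noncomputable def degScale (d : Fin n → ℕ) :
    EuclideanSpace ℝ (Fin n) →L[ℝ] EuclideanSpace ℝ (Fin n) :=
  Matrix.toEuclideanCLM (𝕜 := ℝ) (Matrix.diagonal fun i => (d i : ℝ) ^ (-(1 / 2) : ℝ))

/-- The map `y ↦ diag(dᵢ^(-1/2)) f(y)`. -/
noncomputable def normalizedEval (f : HomogSystem d) (y : EuclideanSpace ℝ (Fin (n + 1))) :
    EuclideanSpace ℝ (Fin n) :=
  degScale d (evalSystem f y)

lemma degScale_apply (v : EuclideanSpace ℝ (Fin n)) (i : Fin n) :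
    degScale d v i = (d i : ℝ) ^ (-(1 / 2) : ℝ) * v i := by
  rw [degScale, Matrix.ofLp_toEuclideanCLM, Matrix.mulVec_diagonal]

lemma degScale_isInvertible (hd : ∀ i, 1 ≤ d i) : (degScale d).IsInvertible := by
  have h0 : ∀ i, (d i : ℝ) ^ (-(1 / 2) : ℝ) ≠ 0 := fun i =>
    (Real.rpow_pos_of_pos (by exact_mod_cast hd i) _).ne'
  have h : ∀ a b : Fin n → ℝ, (∀ i, a i * b i = 1) →
      (Matrix.toEuclideanCLM (𝕜 := ℝ) (Matrix.diagonal a)).comp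
        (Matrix.toEuclideanCLM (𝕜 := ℝ) (Matrix.diagonal b)) = ContinuousLinearMap.id ℝ _ := by
    intro a b hab
    ext v i
    simp [Matrix.mulVec_diagonal, ← mul_assoc, hab]
  exact ContinuousLinearMap.IsInvertible.of_inverse
    (g := Matrix.toEuclideanCLM (𝕜 := ℝ) (Matrix.diagonal fun i => ((d i : ℝ) ^ (-(1 / 2) : ℝ))⁻¹))
    (h _ _ fun i => mul_inv_cancel₀ (h0 i)) (h _ _ fun i => inv_mul_cancel₀ (h0 i))

lemma norm_degScale_apply_le (hd : ∀ i, 1 ≤ d i) (v : EuclideanSpace ℝ (Fin n)) :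
    ‖degScale d v‖ ≤ ‖v‖ := by
  rw [EuclideanSpace.norm_eq, EuclideanSpace.norm_eq]
  refine Real.sqrt_le_sqrt (Finset.sum_le_sum fun i _ => ?_)
  rw [degScale_apply, norm_mul]
  have h1 : (1 : ℝ) ≤ d i := by exact_mod_cast hd i
  have h2 : ‖(d i : ℝ) ^ (-(1 / 2) : ℝ)‖ ≤ 1 := by
    rw [Real.norm_of_nonneg (by positivity)]
    exact Real.rpow_le_one_of_one_le_of_nonpos h1 (by norm_num)
  have := mul_le_of_le_one_left (norm_nonneg (v i)) h2
  gcongr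

lemma homogeneous_component (f : HomogSystem d) (i : Fin n) :
    (f i).1.IsHomogeneous (d i) :=
  (MvPolynomial.mem_homogeneousSubmodule _ _).mp (f i).2

lemma evalSystem_smul (f : HomogSystem d) (t : ℝ) (y : EuclideanSpace ℝ (Fin (n + 1))) (i : Fin n) :
    evalSystem f (t • y) i = t ^ d i * evalSystem f y i := by
  simp only [evalSystem]
  rw [← polarForm_diagonal (homogeneous_component f i),
    ← polarForm_diagonal (homogeneous_component f i)]
  have := (polarForm (d i) (f i).1).map_smul_univ (fun _ => t) (fun _ => y)
  simpa using this

lemma contDiff_evalSystem (f : HomogSystem d) (N : WithTop ℕ∞) : ContDiff ℝ N (evalSystem f) :=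
  contDiff_euclidean.mpr fun i => contDiff_eval (homogeneous_component f i) N

lemma contDiff_normalizedEval (f : HomogSystem d) (N : WithTop ℕ∞) :
    ContDiff ℝ N (normalizedEval f) :=
  (degScale d).contDiff.comp (contDiff_evalSystem f N)

lemma differentiable_evalSystem (f : HomogSystem d) : Differentiable ℝ (evalSystem f) :=
  (contDiff_evalSystem f 1).differentiable one_ne_zero

lemma differentiable_normalizedEval (f : HomogSystem d) : Differentiable ℝ (normalizedEval f) :=
  (contDiff_normalizedEval f 1).differentiable one_ne_zero

lemma weylInner_self_nonneg (p : MvPolynomial (Fin (n + 1)) ℝ) : 0 ≤ weylInner p p :=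
  Finset.sum_nonneg fun a _ => div_nonneg (mul_self_nonneg _) (multinomial_pos a).le

/-- Componentwise bounds on the derivatives, weighted by the norms of the components of `f`, add up
to a bound by `‖f‖`. -/
lemma norm_iteratedFDeriv_normalizedEval_le (f : HomogSystem d) (k : ℕ)
    (w : EuclideanSpace ℝ (Fin (n + 1))) {C : ℝ} (hC0 : 0 ≤ C)
    (hC : ∀ i, (d i : ℝ) ^ (-(1 / 2) : ℝ) * ((d i).descFactorial k * ‖w‖ ^ (d i - k)) ≤ C) :
    ‖iteratedFDeriv ℝ k (normalizedEval f) w‖ ≤ C * systemNorm f := by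
  refine ContinuousMultilinearMap.opNorm_le_bound
    (mul_nonneg hC0 (Real.sqrt_nonneg _)) fun v => ?_
  have hcomp : ∀ i, iteratedFDeriv ℝ k (normalizedEval f) w v i =
      (d i : ℝ) ^ (-(1 / 2) : ℝ) *
        iteratedFDeriv ℝ k (fun y : EuclideanSpace ℝ (Fin (n + 1)) =>
          MvPolynomial.eval (fun j => y j) (f i).1) w v := by
    intro i
    have h1 : (fun y : EuclideanSpace ℝ (Fin (n + 1)) =>
        MvPolynomial.eval (fun j => y j) (f i).1) =
        (EuclideanSpace.proj i : EuclideanSpace ℝ (Fin n) →L[ℝ] ℝ) ∘ evalSystem f := rfl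
    have h2 : normalizedEval f = degScale d ∘ evalSystem f := rfl
    rw [h1, h2, (degScale d).iteratedFDeriv_comp_left (n := k)
      (contDiff_evalSystem f k).contDiffAt le_rfl,
      (EuclideanSpace.proj i : EuclideanSpace ℝ (Fin n) →L[ℝ] ℝ).iteratedFDeriv_comp_left (n := k)
      (contDiff_evalSystem f k).contDiffAt le_rfl]
    simp [degScale_apply]
  have hi : ∀ i, ‖iteratedFDeriv ℝ k (normalizedEval f) w v i‖ ^ 2 ≤
      (C * ∏ l, ‖v l‖) ^ 2 * weylInner (f i).1 (f i).1 := by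
    intro i
    rw [← Real.sq_sqrt (weylInner_self_nonneg (f i).1), ← mul_pow, hcomp, norm_mul,
      Real.norm_of_nonneg (by positivity)]
    have h3 := ContinuousMultilinearMap.le_of_opNorm_le
      (norm_iteratedFDeriv_eval_le (homogeneous_component f i) k w) v
    have hP : 0 ≤ ∏ l, ‖v l‖ := Finset.prod_nonneg fun _ _ => norm_nonneg _
    refine pow_le_pow_left₀ (by positivity) ?_ 2
    calc _ ≤ (d i : ℝ) ^ (-(1 / 2) : ℝ) * ((d i).descFactorial k *
            √(weylInner (f i).1 (f i).1) * ‖w‖ ^ (d i - k) * ∏ l, ‖v l‖) := by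
          gcongr; exact h3
      _ = ((d i : ℝ) ^ (-(1 / 2) : ℝ) * ((d i).descFactorial k * ‖w‖ ^ (d i - k))) *
          ((∏ l, ‖v l‖) * √(weylInner (f i).1 (f i).1)) := by ring
      _ ≤ C * ((∏ l, ‖v l‖) * √(weylInner (f i).1 (f i).1)) := by gcongr; exact hC i
      _ = _ := by ring
  have hP : 0 ≤ ∏ l, ‖v l‖ := Finset.prod_nonneg fun _ _ => norm_nonneg _
  rw [EuclideanSpace.norm_eq]
  refine (Real.sqrt_le_sqrt (Finset.sum_le_sum fun i _ => hi i)).trans ?_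
  rw [← Finset.mul_sum, Real.sqrt_mul (sq_nonneg _), Real.sqrt_sq (by positivity), systemNorm]
  exact le_of_eq (by ring)

lemma le_maxDegree (i : Fin n) : d i ≤ maxDegree d :=
  Finset.le_sup (f := d) (Finset.mem_univ i)

/-- `d^(-1/2) d! / (d - k)! ≤ (max d)^(k - 1/2)`. -/
lemma rpow_mul_descFactorial_le (hd : ∀ i, 1 ≤ d i) (i : Fin n) {k : ℕ} (hk : 1 ≤ k) :
    (d i : ℝ) ^ (-(1 / 2) : ℝ) * (d i).descFactorial k ≤ √(maxDegree d) ^ (2 * k - 1) := by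
  have h1 : (0 : ℝ) < d i := by exact_mod_cast hd i
  have h2 : ((d i).descFactorial k : ℝ) ≤ (d i : ℝ) ^ k := by
    exact_mod_cast Nat.descFactorial_le_pow _ _
  have h3 : (d i : ℝ) ^ (-(1 / 2) : ℝ) = (√(d i))⁻¹ := by
    rw [Real.rpow_neg h1.le, Real.sqrt_eq_rpow]
  have h4 : (0 : ℝ) < √(d i) := Real.sqrt_pos.mpr h1
  have h5 : √(d i) ≤ √(maxDegree d) := Real.sqrt_le_sqrt (by exact_mod_cast le_maxDegree i)
  calc (d i : ℝ) ^ (-(1 / 2) : ℝ) * (d i).descFactorial k ≤ (√(d i))⁻¹ * (d i : ℝ) ^ k := by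
        rw [h3]; gcongr
    _ = √(d i) ^ (2 * k - 1) := by
        have : (d i : ℝ) ^ k = √(d i) ^ (2 * k - 1) * √(d i) := by
          rw [← pow_succ, Nat.sub_add_cancel (by omega), pow_mul, Real.sq_sqrt h1.le]
        rw [this]; field_simp
    _ ≤ _ := by gcongr

/-- Higher derivatives of a normalized system of norm one at a unit vector. -/
lemma norm_iteratedFDeriv_normalizedEval_le_of_norm_eq_one (hd : ∀ i, 1 ≤ d i) (f : HomogSystem d)
    (hf : systemNorm f = 1) {x : EuclideanSpace ℝ (Fin (n + 1))} (hx : ‖x‖ = 1) {k : ℕ}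
    (hk : 1 ≤ k) :
    ‖iteratedFDeriv ℝ k (normalizedEval f) x‖ ≤ √(maxDegree d) ^ (2 * k - 1) := by
  have := norm_iteratedFDeriv_normalizedEval_le f k x (C := √(maxDegree d) ^ (2 * k - 1))
    (by positivity) (fun i => by
      rw [hx, one_pow, mul_one]; exact rpow_mul_descFactorial_le hd i hk)
  rwa [hf, mul_one] at this

/-- The derivative of a normalized system of norm one is Lipschitz with constant
`(max d)^(3/2) B` on the ball of radius `ρ` around the origin, where `B` bounds the `ρ^(d - 2)`. -/
lemma norm_fderiv_normalizedEval_sub_le (hd : ∀ i, 1 ≤ d i) (f : HomogSystem d)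
    (hf : systemNorm f = 1) {ρ B : ℝ} (hB0 : 0 ≤ B) (hB : ∀ i, ρ ^ (d i - 2) ≤ B)
    {X Y : EuclideanSpace ℝ (Fin (n + 1))} (hX : ‖X‖ ≤ ρ) (hY : ‖Y‖ ≤ ρ) :
    ‖fderiv ℝ (normalizedEval f) Y - fderiv ℝ (normalizedEval f) X‖ ≤
      √(maxDegree d) ^ 3 * B * ‖Y - X‖ := by
  have hdiff : Differentiable ℝ (fderiv ℝ (normalizedEval f)) :=
    ((contDiff_normalizedEval f 2).fderiv_right (m := 1) (by norm_num)).differentiable one_ne_zero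
  have hconv := convex_closedBall (0 : EuclideanSpace ℝ (Fin (n + 1))) ρ
  refine hconv.norm_image_sub_le_of_norm_fderiv_le (𝕜 := ℝ) (fun w _ => hdiff w) (fun w hw => ?_)
    (mem_closedBall_zero_iff.mpr hX) (mem_closedBall_zero_iff.mpr hY)
  have hw' : ‖w‖ ≤ ρ := mem_closedBall_zero_iff.mp hw
  have h2 : ‖fderiv ℝ (fderiv ℝ (normalizedEval f)) w‖ =
      ‖iteratedFDeriv ℝ 2 (normalizedEval f) w‖ := by
    rw [← norm_iteratedFDeriv_fderiv, ← norm_iteratedFDeriv_fderiv, norm_iteratedFDeriv_zero]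
  rw [h2]
  have := norm_iteratedFDeriv_normalizedEval_le f 2 w (C := √(maxDegree d) ^ 3 * B)
    (by positivity) (fun i => by
      rw [← mul_assoc]
      have h3 : ‖w‖ ^ (d i - 2) ≤ B := (pow_le_pow_left₀ (norm_nonneg _) hw' _).trans (hB i)
      have h4 := rpow_mul_descFactorial_le hd i (k := 2) (by norm_num)
      gcongr)
  rwa [hf, mul_one] at this

/-! ### Restriction to affine charts -/

lemma differentiable_affineRestriction (f : HomogSystem d) (z : EuclideanSpace ℝ (Fin (n + 1))) :
    Differentiable ℝ (affineRestriction f z) :=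
  (differentiable_evalSystem f).comp ((perp z).subtypeL.differentiable.const_add z)

lemma differentiable_degScale_affineRestriction (f : HomogSystem d)
    (z : EuclideanSpace ℝ (Fin (n + 1))) :
    Differentiable ℝ fun X => degScale d (affineRestriction f z X) :=
  (degScale d).differentiable.comp (differentiable_affineRestriction f z)

lemma fderiv_degScale_affineRestriction (f : HomogSystem d)
    (z : EuclideanSpace ℝ (Fin (n + 1))) (X : perp z) :
    fderiv ℝ (fun X => degScale d (affineRestriction f z X)) X =
      (fderiv ℝ (normalizedEval f) (z + X)).comp (perp z).subtypeL := by
  have h1 : HasFDerivAt (fun X : perp z => z + (X : EuclideanSpace ℝ (Fin (n + 1))))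
      (perp z).subtypeL X := (perp z).subtypeL.hasFDerivAt.const_add z
  exact ((differentiable_normalizedEval f (z + X)).hasFDerivAt.comp X h1).fderiv

lemma norm_iteratedFDeriv_degScale_affineRestriction_le (f : HomogSystem d)
    (z : EuclideanSpace ℝ (Fin (n + 1))) (k : ℕ) :
    ‖iteratedFDeriv ℝ k (fun X => degScale d (affineRestriction f z X)) 0‖ ≤
      ‖iteratedFDeriv ℝ k (normalizedEval f) z‖ := by
  have h1 : (fun X => degScale d (affineRestriction f z X)) =
      (fun y => normalizedEval f (z + y)) ∘ (perp z).subtypeL := rfl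
  have h2 : ContDiff ℝ k fun y => normalizedEval f (z + y) :=
    (contDiff_normalizedEval f k).comp (contDiff_const.add contDiff_id)
  rw [h1, (perp z).subtypeL.iteratedFDeriv_comp_right h2 0 le_rfl, iteratedFDeriv_comp_add_left]
  refine (ContinuousMultilinearMap.norm_compContinuousLinearMap_le _ _).trans ?_
  rw [map_zero, add_zero]
  exact mul_le_of_le_one_right (norm_nonneg _) (Finset.prod_le_one (fun _ _ => norm_nonneg _)
    fun _ _ => (perp z).norm_subtypeL_le)

lemma finrank_perp {z : EuclideanSpace ℝ (Fin (n + 1))} (hz : ‖z‖ = 1) :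
    Module.finrank ℝ (perp z) = Module.finrank ℝ (EuclideanSpace ℝ (Fin n)) := by
  have : Fact (Module.finrank ℝ (EuclideanSpace ℝ (Fin (n + 1))) = n + 1) := ⟨by simp⟩
  rw [Submodule.finrank_orthogonal_span_singleton (n := n) (by rintro rfl; simp at hz)]
  simp

lemma norm_add_perp_sq {z : EuclideanSpace ℝ (Fin (n + 1))} (hz : ‖z‖ = 1) (X : perp z) :
    ‖z + (X : EuclideanSpace ℝ (Fin (n + 1)))‖ ^ 2 = 1 + ‖X‖ ^ 2 := by
  have h := Submodule.mem_orthogonal_singleton_iff_inner_right.mp X.2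
  rw [norm_add_sq_real, h, hz]
  simp

/-- At a unit vector, `scaledDeriv` is the derivative of the normalized system in the chart. -/
lemma scaledDeriv_eq (f : HomogSystem d) {x : EuclideanSpace ℝ (Fin (n + 1))} (hx : ‖x‖ = 1) :
    scaledDeriv f x = (fderiv ℝ (normalizedEval f) x).comp (perp x).subtypeL := by
  have h1 : fderiv ℝ (normalizedEval f) x = (degScale d).comp (fderiv ℝ (evalSystem f) x) :=
    fderiv_comp_left (differentiable_evalSystem f) x
  rw [h1, scaledDeriv]
  simp only [hx, one_zpow, mul_one]
  rfl

/-- On the ball of radius `t` of a chart, the derivative of the normalized system is Lipschitz with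
constant `(max d)^(3/2) / (1 - (max d) t² / 2)`: the points of that ball have norm at most
`1 + t² / 2`. -/
lemma norm_fderiv_degScale_affineRestriction_sub_le (hd : ∀ i, 1 ≤ d i) (f : HomogSystem d)
    (hf : systemNorm f = 1) {z : EuclideanSpace ℝ (Fin (n + 1))} (hz : ‖z‖ = 1) {t B : ℝ}
    (ht1 : maxDegree d * t ^ 2 / 2 < 1) (htB : 1 / (1 - maxDegree d * t ^ 2 / 2) ≤ B)
    {X Y : perp z} (hX : ‖X‖ ≤ t) (hY : ‖Y‖ ≤ t) :
    ‖fderiv ℝ (fun X => degScale d (affineRestriction f z X)) Y -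
        fderiv ℝ (fun X => degScale d (affineRestriction f z X)) X‖ ≤
      √(maxDegree d) ^ 3 * B * ‖Y - X‖ := by
  have ht0 : 0 ≤ t := (norm_nonneg _).trans hX
  have hB0 : 0 ≤ B := le_trans (by have := sub_pos.mpr ht1; positivity) htB
  have hB : ∀ i, (1 + t ^ 2 / 2) ^ (d i - 2) ≤ B := by
    intro i
    refine le_trans ?_ htB
    rw [le_div_iff₀ (sub_pos.mpr ht1)]
    have h1 : (1 + t ^ 2 / 2) ^ (d i - 2) ≤ (1 + t ^ 2 / 2) ^ maxDegree d :=
      pow_le_pow_right₀ (by nlinarith [sq_nonneg t])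
        ((Nat.sub_le _ _).trans (le_maxDegree i))
    have h2 : (1 + t ^ 2 / 2) ^ maxDegree d ≤ Real.exp (maxDegree d * t ^ 2 / 2) := by
      calc (1 + t ^ 2 / 2) ^ maxDegree d ≤ Real.exp (t ^ 2 / 2) ^ maxDegree d := by
            gcongr
            have := Real.add_one_le_exp (t ^ 2 / 2)
            linarith
        _ = _ := by rw [← Real.exp_nat_mul]; ring_nf
    have h3 := Real.add_one_le_exp (-(maxDegree d * t ^ 2 / 2))
    calc (1 + t ^ 2 / 2) ^ (d i - 2) * (1 - maxDegree d * t ^ 2 / 2)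
        ≤ Real.exp (maxDegree d * t ^ 2 / 2) * Real.exp (-(maxDegree d * t ^ 2 / 2)) := by
          refine mul_le_mul (h1.trans h2) (by linarith) (by linarith) (Real.exp_pos _).le
      _ = 1 := by rw [← Real.exp_add]; simp
  have hnorm : ∀ W : perp z, ‖W‖ ≤ t →
      ‖z + (W : EuclideanSpace ℝ (Fin (n + 1)))‖ ≤ 1 + t ^ 2 / 2 := by
    intro W hW
    refine abs_le_of_sq_le_sq' ?_ (by positivity) |>.2
    rw [norm_add_perp_sq hz]
    nlinarith [norm_nonneg W, sq_nonneg (t ^ 2)]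
  rw [fderiv_degScale_affineRestriction, fderiv_degScale_affineRestriction,
    ← ContinuousLinearMap.sub_comp]
  refine (ContinuousLinearMap.opNorm_comp_le _ _).trans
    ((mul_le_of_le_one_right (norm_nonneg _) (perp z).norm_subtypeL_le).trans ?_)
  have := norm_fderiv_normalizedEval_sub_le hd f hf hB0 hB (hnorm X hX) (hnorm Y hY)
  rw [add_sub_add_left_eq_sub] at this
  exact this

end Systems

/-! ### The constants `α_*` and `r₀(α_*)` -/

lemma alphaStar_mem : alphaStar ∈ alphaStarRoots := isLeast_alphaStar.1

lemma alphaStar_mul_rZero : alphaStar * rZero alphaStar =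
    (1 + alphaStar - √(1 - 6 * alphaStar + alphaStar ^ 2)) / 4 := by
  have := alphaStar_mem.1
  rw [rZero]; field_simp

lemma alphaStar_le : alphaStar ≤ 1 / 8 := by
  obtain ⟨h0, h1, h2⟩ := alphaStar_mem
  have hs := alphaStar_mul_rZero
  have hα := alphaZero_lt
  have hα0 := alphaZero_pos
  set a := alphaStar
  set r := √(1 - 6 * a + a ^ 2) with hr
  have hr0 : 0 ≤ r := Real.sqrt_nonneg _
  rw [hs] at h2
  by_contra! hlt
  -- a first bound from `(1 - α r₀) ^ 2 ≤ 1`, improved by `α r₀ ≥ α`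
  have hr1 : r ≤ 1 + a := by
    rw [hr, Real.sqrt_le_left (by linarith)]; nlinarith
  have hr2 : a - 7 ≤ r := by
    rcases le_total a 7 with h | h
    · linarith
    · exact Real.le_sqrt_of_sq_le (by nlinarith)
  have hsq : (1 - (1 + a - r) / 4) ^ 2 ≤ 1 := by
    rw [sq_le_one_iff_abs_le_one, abs_le]; constructor <;> linarith
  have ha2 : a ≤ 1 / 5 := by nlinarith
  have hr3 : r ≤ 1 - 3 * a := by
    rw [hr, Real.sqrt_le_left (by linarith)]; nlinarith
  have h3 : (1 - (1 + a - r) / 4) ^ 2 ≤ (1 - a) ^ 2 := by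
    refine pow_le_pow_left₀ (by linarith) (by linarith) 2
  have h4 : (1 - a) ^ 2 ≤ (7 / 8) ^ 2 := pow_le_pow_left₀ (by linarith) (by linarith) 2
  nlinarith

lemma rZero_alphaStar_le : rZero alphaStar ≤ 5 / 4 := by
  obtain ⟨h0, -, -⟩ := alphaStar_mem
  have h1 := alphaStar_le
  have hs := alphaStar_mul_rZero
  have h2 : 1 - 4 * alphaStar ≤ √(1 - 6 * alphaStar + alphaStar ^ 2) :=
    Real.le_sqrt_of_sq_le (by nlinarith)
  refine le_of_mul_le_mul_left (a := alphaStar) ?_ h0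
  linarith

lemma le_rZero_alphaStar : 9 / 8 ≤ rZero alphaStar := by
  obtain ⟨h0, -, h3⟩ := alphaStar_mem
  have h1 := alphaStar_le
  have hs := alphaStar_mul_rZero
  have hr := rZero_alphaStar_le
  have hα : (3 : ℝ) / 20 ≤ alphaZero := by
    have : √17 ≤ 62 / 15 := by rw [Real.sqrt_le_left (by norm_num)]; norm_num
    unfold alphaZero; linarith
  have h2 : alphaStar * rZero alphaStar ≤ 5 / 32 := by nlinarith
  have h4 : (27 / 32 : ℝ) ^ 2 ≤ (1 - alphaStar * rZero alphaStar) ^ 2 :=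
    pow_le_pow_left₀ (by norm_num) (by linarith) 2
  have h5 : (1 : ℝ) / 10 ≤ alphaStar := by nlinarith
  have h6 : √(1 - 6 * alphaStar + alphaStar ^ 2) ≤ 1 - 7 / 2 * alphaStar := by
    rw [Real.sqrt_le_left (by linarith)]; nlinarith
  refine le_of_mul_le_mul_left (a := alphaStar) ?_ h0
  linarith

/-! ### The derivative at a zero -/

section Zero

variable {n : ℕ} {d : Fin n → ℕ}

lemma normalizedEval_smul (f : HomogSystem d) (t : ℝ) (y : EuclideanSpace ℝ (Fin (n + 1)))
    (i : Fin n) : normalizedEval f (t • y) i = t ^ d i * normalizedEval f y i := by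
  simp only [normalizedEval, degScale_apply, evalSystem_smul]
  ring

lemma evalSystem_smul_eq_zero (f : HomogSystem d) {y : EuclideanSpace ℝ (Fin (n + 1))}
    (hy : evalSystem f y = 0) (t : ℝ) : evalSystem f (t • y) = 0 := by
  ext i
  rw [evalSystem_smul, hy]
  simp

/-- Euler's identity at a zero. -/
lemma fderiv_normalizedEval_self (f : HomogSystem d) {y : EuclideanSpace ℝ (Fin (n + 1))}
    (hy : evalSystem f y = 0) : fderiv ℝ (normalizedEval f) y y = 0 := by
  have h1 : HasDerivAt (fun t : ℝ => t • y) y 1 := by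
    simpa using (hasDerivAt_id (1 : ℝ)).smul_const y
  have h2 : HasFDerivAt (normalizedEval f) (fderiv ℝ (normalizedEval f) y) ((1 : ℝ) • y) := by
    rw [one_smul]; exact (differentiable_normalizedEval f y).hasFDerivAt
  have h3 := h2.comp_hasDerivAt (1 : ℝ) h1
  have h4 : (normalizedEval f ∘ fun t : ℝ => t • y) = fun _ => 0 := by
    ext1 t
    simp [normalizedEval, evalSystem_smul_eq_zero f hy]
  rw [h4] at h3
  exact h3.unique (hasDerivAt_const _ _)

/-- Moving away from the origin along a ray does not shrink the derivative, which is homogeneous. -/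
lemma norm_fderiv_normalizedEval_le_smul (hd : ∀ i, 1 ≤ d i) (f : HomogSystem d) {t : ℝ}
    (ht : 1 ≤ t) (y v : EuclideanSpace ℝ (Fin (n + 1))) :
    ‖fderiv ℝ (normalizedEval f) y v‖ ≤ ‖fderiv ℝ (normalizedEval f) (t • y) v‖ := by
  have ht0 : 0 < t := by linarith
  have hcomp : ∀ w, ∀ i, HasFDerivAt (fun y => normalizedEval f y i)
      ((EuclideanSpace.proj i : EuclideanSpace ℝ (Fin n) →L[ℝ] ℝ).comp
        (fderiv ℝ (normalizedEval f) w)) w := fun w i =>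
    (EuclideanSpace.proj i : EuclideanSpace ℝ (Fin n) →L[ℝ] ℝ).hasFDerivAt.comp w
      (differentiable_normalizedEval f w).hasFDerivAt
  have key : ∀ i, fderiv ℝ (normalizedEval f) (t • y) v i =
      t ^ (d i - 1) * fderiv ℝ (normalizedEval f) y v i := by
    intro i
    have h1 := fderiv_comp_smul (𝕜 := ℝ) (f := fun y => normalizedEval f y i) (x := y) t
    rw [(hcomp (t • y) i).fderiv] at h1
    simp only [normalizedEval_smul] at h1
    rw [((hcomp y i).const_mul (t ^ d i)).fderiv] at h1
    have h2 := congrArg (fun T => T v) h1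
    simp only [smul_apply, ContinuousLinearMap.comp_apply,
      EuclideanSpace.coe_proj, smul_eq_mul] at h2
    have h3 : t ^ d i = t * t ^ (d i - 1) := by
      rw [← pow_succ', Nat.sub_add_cancel (hd i)]
    rw [h3, mul_assoc] at h2
    exact (mul_left_cancel₀ ht0.ne' h2).symm
  rw [EuclideanSpace.norm_eq, EuclideanSpace.norm_eq]
  refine Real.sqrt_le_sqrt (Finset.sum_le_sum fun i _ => ?_)
  rw [key, norm_mul]
  have h1 : 1 ≤ ‖t ^ (d i - 1)‖ := by
    rw [Real.norm_of_nonneg (by positivity)]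
    exact one_le_pow₀ ht
  have := le_mul_of_one_le_left (norm_nonneg (fderiv ℝ (normalizedEval f) y v i)) h1
  gcongr

variable {V W : Type*} [NormedAddCommGroup V] [InnerProductSpace ℝ V] [NormedAddCommGroup W]
  [NormedSpace ℝ W]

lemma inner_mul_norm_le_norm_add_smul {z ζ w : V} (hz : ‖z‖ = 1) (hζ : ‖ζ‖ = 1)
    (hw : inner ℝ z w = 0) (s : ℝ) : |inner ℝ z ζ| * ‖w‖ ≤ ‖w + s • ζ‖ := by
  set c := inner ℝ z ζ with hc
  have h1 : inner ℝ w ζ = inner ℝ w (ζ - c • z) := by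
    rw [inner_sub_right, inner_smul_right, real_inner_comm, real_inner_comm z w, hw]; simp
  have h2 : ‖ζ - c • z‖ ^ 2 = 1 - c ^ 2 := by
    rw [norm_sub_sq_real, inner_smul_right, real_inner_comm, ← hc, norm_smul, hz, hζ]
    simp only [mul_one, Real.norm_eq_abs, sq_abs]
    ring
  have h3 : inner ℝ w ζ ^ 2 ≤ ‖w‖ ^ 2 * (1 - c ^ 2) := by
    rw [h1, ← h2, ← mul_pow]
    exact sq_le_sq.mpr (by
      rw [abs_of_nonneg (by positivity : 0 ≤ ‖w‖ * ‖ζ - c • z‖)]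
      exact abs_real_inner_le_norm _ _)
  refine abs_le_of_sq_le_sq' ?_ (norm_nonneg _) |>.2
  rw [norm_add_sq_real, inner_smul_right, norm_smul, hζ, mul_pow, sq_abs]
  simp only [mul_one, Real.norm_eq_abs, sq_abs]
  nlinarith [sq_nonneg (s + inner ℝ w ζ)]

/-- A linear map that kills `ζ` and is bounded below by `m` on `x^⊥` is bounded below by
`m ⟨z, ζ⟩` on `z^⊥`: every `w ∈ z^⊥` differs from a vector of `x^⊥` by a multiple of `ζ`. -/
lemma lower_bound_change_chart {T : V →L[ℝ] W} {x z ζ : V} (hz : ‖z‖ = 1) (hζ : ‖ζ‖ = 1)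
    (hT : T ζ = 0) (hxζ : inner ℝ x ζ ≠ 0) {m : ℝ} (hm0 : 0 ≤ m)
    (hm : ∀ v, inner ℝ x v = 0 → m * ‖v‖ ≤ ‖T v‖) {w : V} (hw : inner ℝ z w = 0) :
    m * inner ℝ z ζ * ‖w‖ ≤ ‖T w‖ := by
  set s : ℝ := -(inner ℝ x w / inner ℝ x ζ) with hs
  have h1 : inner ℝ x (w + s • ζ) = 0 := by
    rw [inner_add_right, inner_smul_right, hs]; field_simp; ring
  have h2 := hm _ h1
  rw [map_add, map_smul, hT, smul_zero, add_zero] at h2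
  refine le_trans ?_ h2
  rw [mul_assoc]
  gcongr
  refine le_trans ?_ (inner_mul_norm_le_norm_add_smul hz hζ hw s)
  gcongr
  exact le_abs_self _

/-- The chord is at most the arc. -/
lemma norm_sub_le_angle {x y : V} (hx : ‖x‖ = 1) (hy : ‖y‖ = 1) :
    ‖x - y‖ ≤ InnerProductGeometry.angle x y := by
  refine abs_le_of_sq_le_sq' ?_ (InnerProductGeometry.angle_nonneg _ _) |>.2
  have h1 := InnerProductGeometry.cos_angle x y
  rw [hx, hy, mul_one, div_one] at h1
  rw [norm_sub_sq_real, hx, hy, ← h1]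
  have := Real.one_sub_sq_div_two_le_cos (x := InnerProductGeometry.angle x y)
  linarith

end Zero

section Main

variable {n : ℕ} {d : Fin n → ℕ}

/-! ### The condition number as a lower bound for the derivative -/

lemma scaledDeriv_lower_bound {f : HomogSystem d} {x : EuclideanSpace ℝ (Fin (n + 1))}
    (hI : (scaledDeriv f x).IsInvertible) (hμ : 0 < ‖(scaledDeriv f x).inverse‖) (v : perp x) :
    ‖(scaledDeriv f x).inverse‖⁻¹ * ‖v‖ ≤ ‖scaledDeriv f x v‖ := by
  rw [inv_mul_le_iff₀ hμ]
  simpa [hI.inverse_apply_self] using (scaledDeriv f x).inverse.le_opNorm (scaledDeriv f x v)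

/-- The condition number is at least `(max d)^(-1/2)`. -/
lemma one_le_sqrt_maxDegree_mul (hd : ∀ i, 1 ≤ d i) {f : HomogSystem d} (hf : systemNorm f = 1)
    {x : EuclideanSpace ℝ (Fin (n + 1))} (hx : ‖x‖ = 1) (hI : (scaledDeriv f x).IsInvertible) :
    1 ≤ √(maxDegree d) * ‖(scaledDeriv f x).inverse‖ := by
  have hn : Nonempty (Fin n) := by
    by_contra hne
    rw [not_nonempty_iff] at hne
    simp [systemNorm] at hf
  obtain ⟨i⟩ := hn
  set y : EuclideanSpace ℝ (Fin n) := EuclideanSpace.single i 1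
  have hy : ‖y‖ = 1 := by simp [y]
  have h1 : ‖scaledDeriv f x‖ ≤ √(maxDegree d) := by
    rw [scaledDeriv_eq f hx]
    refine (ContinuousLinearMap.opNorm_comp_le _ _).trans
      ((mul_le_of_le_one_right (norm_nonneg _) (perp x).norm_subtypeL_le).trans ?_)
    have := norm_iteratedFDeriv_normalizedEval_le_of_norm_eq_one hd f hf hx (k := 1) le_rfl
    rwa [norm_iteratedFDeriv_one, show 2 * 1 - 1 = 1 from rfl, pow_one] at this
  calc 1 = ‖scaledDeriv f x ((scaledDeriv f x).inverse y)‖ := by rw [hI.self_apply_inverse, hy]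
    _ ≤ ‖scaledDeriv f x‖ * (‖(scaledDeriv f x).inverse‖ * ‖y‖) :=
      (ContinuousLinearMap.le_opNorm _ _).trans (by
        gcongr; exact ContinuousLinearMap.le_opNorm _ _)
    _ ≤ _ := by rw [hy, mul_one]; gcongr

lemma norm_inverse_pos (hd : ∀ i, 1 ≤ d i) {f : HomogSystem d} (hf : systemNorm f = 1)
    {x : EuclideanSpace ℝ (Fin (n + 1))} (hx : ‖x‖ = 1) (hI : (scaledDeriv f x).IsInvertible) :
    0 < ‖(scaledDeriv f x).inverse‖ := by
  have hqμ := one_le_sqrt_maxDegree_mul hd hf hx hI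
  refine lt_of_le_of_ne (norm_nonneg (scaledDeriv f x).inverse) fun h0 => ?_
  rw [← h0, mul_zero] at hqμ
  linarith

lemma one_le_maxDegree (hd : ∀ i, 1 ≤ d i) {f : HomogSystem d} (hf : systemNorm f = 1)
    {x : EuclideanSpace ℝ (Fin (n + 1))} (hx : ‖x‖ = 1) (hI : (scaledDeriv f x).IsInvertible) :
    (1 : ℝ) ≤ maxDegree d := by
  have hqμ := one_le_sqrt_maxDegree_mul hd hf hx hI
  rw [Nat.one_le_cast, Nat.one_le_iff_ne_zero]
  intro h0
  rw [h0] at hqμ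
  norm_num at hqμ

/-! ### Smale's invariants in the chart at `x` -/

lemma fderiv_affineRestriction_zero (f : HomogSystem d)
    {x : EuclideanSpace ℝ (Fin (n + 1))} (hx : ‖x‖ = 1) :
    (degScale d).comp (fderiv ℝ (affineRestriction f x) 0) = scaledDeriv f x := by
  rw [← fderiv_comp_left (differentiable_affineRestriction f x),
    fderiv_degScale_affineRestriction, scaledDeriv_eq f hx]
  simp

lemma fderiv_affineRestriction_zero_isInvertible (hd : ∀ i, 1 ≤ d i) {f : HomogSystem d}
    {x : EuclideanSpace ℝ (Fin (n + 1))} (hx : ‖x‖ = 1) (hI : (scaledDeriv f x).IsInvertible) :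
    (fderiv ℝ (affineRestriction f x) 0).IsInvertible := by
  rwa [← isInvertible_comp_left_iff (degScale_isInvertible hd),
    fderiv_affineRestriction_zero f hx]

lemma inverse_fderiv_affineRestriction_zero (hd : ∀ i, 1 ≤ d i) (f : HomogSystem d)
    {x : EuclideanSpace ℝ (Fin (n + 1))} (hx : ‖x‖ = 1) :
    (fderiv ℝ (affineRestriction f x) 0).inverse =
      (scaledDeriv f x).inverse.comp (degScale d) := by
  have hS := degScale_isInvertible hd
  rw [← fderiv_affineRestriction_zero f hx, hS.inverse_comp_of_left,
    ContinuousLinearMap.comp_assoc, hS.inverse_comp_self, ContinuousLinearMap.comp_id]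

lemma norm_inverse_fderiv_apply_le (hd : ∀ i, 1 ≤ d i) (f : HomogSystem d)
    {x : EuclideanSpace ℝ (Fin (n + 1))} (hx : ‖x‖ = 1) :
    ‖(fderiv ℝ (affineRestriction f x) 0).inverse (affineRestriction f x 0)‖ ≤
      ‖(scaledDeriv f x).inverse‖ * ‖evalSystem f x‖ := by
  rw [inverse_fderiv_affineRestriction_zero hd f hx, ContinuousLinearMap.comp_apply]
  refine (ContinuousLinearMap.le_opNorm _ _).trans ?_
  gcongr
  refine (norm_degScale_apply_le hd _).trans ?_
  simp [affineRestriction]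

/-- The higher derivative estimate `γ(F_x, 0) ≤ (max d)^(3/2) μ(f, x)`. With `q = (max d)^(1/2)`, the
`k`-th term is `μ q^(2 k - 1)`, and the missing factor `(q μ)^(k - 2)` is at least `1`. -/
lemma gammaInv_affineRestriction_le (hd : ∀ i, 1 ≤ d i) {f : HomogSystem d}
    (hf : systemNorm f = 1) {x : EuclideanSpace ℝ (Fin (n + 1))} (hx : ‖x‖ = 1)
    (hI : (scaledDeriv f x).IsInvertible) :
    gammaInv (affineRestriction f x) 0 ≤
      ENNReal.ofReal (√(maxDegree d) ^ 3 * ‖(scaledDeriv f x).inverse‖) := by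
  rw [gammaInv, if_pos (fderiv_affineRestriction_zero_isInvertible hd hx hI)]
  refine iSup₂_le fun k hk => ENNReal.ofReal_le_ofReal ?_
  have hqμ := one_le_sqrt_maxDegree_mul hd hf hx hI
  set q := √(maxDegree d)
  have hq0 : 0 ≤ q := Real.sqrt_nonneg _
  set μ := ‖(scaledDeriv f x).inverse‖ with hμ
  have hμ0 : 0 ≤ μ := norm_nonneg (scaledDeriv f x).inverse
  obtain ⟨j, rfl⟩ : ∃ j, k = j + 2 := ⟨k - 2, by omega⟩
  have h1 : (fderiv ℝ (affineRestriction f x) 0).inverse.compContinuousMultilinearMap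
      (iteratedFDeriv ℝ (j + 2) (affineRestriction f x) 0) =
      (scaledDeriv f x).inverse.compContinuousMultilinearMap
        (iteratedFDeriv ℝ (j + 2) (fun X => degScale d (affineRestriction f x X)) 0) := by
    have hc : ContDiff ℝ (j + 2 : ℕ) (affineRestriction f x) :=
      (contDiff_evalSystem f _).comp (contDiff_const.add (perp x).subtypeL.contDiff)
    have h2 : (fun X => degScale d (affineRestriction f x X)) =
      degScale d ∘ affineRestriction f x := rfl
    rw [h2, (degScale d).iteratedFDeriv_comp_left hc.contDiffAt le_rfl,
      inverse_fderiv_affineRestriction_zero hd f hx]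
    rfl
  have h3 : ‖(fderiv ℝ (affineRestriction f x) 0).inverse.compContinuousMultilinearMap
      (iteratedFDeriv ℝ (j + 2) (affineRestriction f x) 0)‖ / ((j + 2).factorial : ℝ) ≤
      (q ^ 3 * μ) ^ (j + 1) := by
    have hfac : (1 : ℝ) ≤ (j + 2).factorial := by exact_mod_cast Nat.factorial_pos _
    rw [h1, div_le_iff₀ (by positivity)]
    refine (ContinuousLinearMap.norm_compContinuousMultilinearMap_le _ _).trans ?_
    have h4 := (norm_iteratedFDeriv_degScale_affineRestriction_le f x (j + 2)).trans
      (norm_iteratedFDeriv_normalizedEval_le_of_norm_eq_one hd f hf hx (by omega))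
    calc _ ≤ μ * q ^ (2 * (j + 2) - 1) := by gcongr
      _ ≤ μ * q ^ (2 * (j + 2) - 1) * (q * μ) ^ j :=
        le_mul_of_one_le_right (by positivity) (one_le_pow₀ hqμ)
      _ = (q ^ 3 * μ) ^ (j + 1) := by
        rw [show 2 * (j + 2) - 1 = 2 * j + 3 by omega]; ring
      _ ≤ _ := le_mul_of_one_le_right (by positivity) hfac
  have h5 : (1 : ℝ) / (((j + 2 : ℕ) : ℝ) - 1) = ((j + 1 : ℕ) : ℝ)⁻¹ := by
    push_cast; rw [one_div]; ring_nf
  rw [h5]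
  refine (Real.rpow_le_rpow (by positivity) h3 (by positivity)).trans ?_
  rw [Real.pow_rpow_inv_natCast (by positivity) (by omega)]

lemma alphaInv_affineRestriction_le (hd : ∀ i, 1 ≤ d i) {f : HomogSystem d}
    (hf : systemNorm f = 1) {x : EuclideanSpace ℝ (Fin (n + 1))} (hx : ‖x‖ = 1)
    (hI : (scaledDeriv f x).IsInvertible) :
    alphaInv (affineRestriction f x) 0 ≤ ENNReal.ofReal
      (√(maxDegree d) ^ 3 * ‖(scaledDeriv f x).inverse‖ ^ 2 * ‖evalSystem f x‖) := by
  have hβ : betaInv (affineRestriction f x) 0 ≤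
      ENNReal.ofReal (‖(scaledDeriv f x).inverse‖ * ‖evalSystem f x‖) := by
    rw [betaInv, if_pos (fderiv_affineRestriction_zero_isInvertible hd hx hI)]
    exact ENNReal.ofReal_le_ofReal (norm_inverse_fderiv_apply_le hd f hx)
  refine (mul_le_mul' hβ (gammaInv_affineRestriction_le hd hf hx hI)).trans (le_of_eq ?_)
  rw [← ENNReal.ofReal_mul (by positivity)]
  congr 1
  ring

/-! ### Convergence from `x` -/

/-- Used with `D = max d` and `q = D^(1/2)`: as `q μ ≥ 1`, a bound on `D^(3/2) μ t` is also a bound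
on `D t`, which controls the growth of `‖z + X‖^(d - 2)` for `‖X‖ ≤ t` in a chart. -/
lemma maxDegree_mul_le {q D μ t : ℝ} (hqD : q ^ 2 = D) (ht : 0 ≤ t) (hqμ : 1 ≤ q * μ) :
    D * t ≤ q ^ 3 * μ * t := by
  have : 0 ≤ D := hqD ▸ sq_nonneg q
  calc D * t ≤ D * t * (q * μ) := le_mul_of_one_le_right (by positivity) hqμ
    _ = _ := by rw [← hqD]; ring

/-- Newton's method in the chart at `x`. The ball of radius `9/8 b` with Lipschitz constant
`8/7 (max d)^(3/2)` and the ratio `1/10` satisfy the requirements of `newton_kantorovich`. -/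
lemma exists_isApproxZeroSecondKind (hd : ∀ i, 1 ≤ d i) {f : HomogSystem d}
    (hf : systemNorm f = 1) {x : EuclideanSpace ℝ (Fin (n + 1))} (hx : ‖x‖ = 1)
    (hI : (scaledDeriv f x).IsInvertible)
    (h : √(maxDegree d) ^ 3 * ‖(scaledDeriv f x).inverse‖ ^ 2 * ‖evalSystem f x‖ ≤ 1 / 8) :
    ∃ X : perp x, IsApproxZeroSecondKind (affineRestriction f x) X 0 ∧
      ‖X‖ ≤ 9 / 8 * (‖(scaledDeriv f x).inverse‖ * ‖evalSystem f x‖) := by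
  have hqμ := one_le_sqrt_maxDegree_mul hd hf hx hI
  have hqD : √(maxDegree d) ^ 2 = (maxDegree d : ℝ) := Real.sq_sqrt (by positivity)
  have hqμ2 := norm_inverse_pos hd hf hx hI
  have hlow := scaledDeriv_lower_bound hI hqμ2
  have hb1 := norm_inverse_fderiv_apply_le hd f hx
  have hlip := fun (t : ℝ) h1 h2 (X Y : perp x) =>
    norm_fderiv_degScale_affineRestriction_sub_le hd f hf hx (t := t) (B := 8 / 7) h1 h2
      (X := X) (Y := Y)
  have hS := degScale_isInvertible hd
  have hDpos := one_le_maxDegree hd hf hx hI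
  set q := √(maxDegree d) with hq
  set D : ℝ := (maxDegree d : ℝ) with hD
  set μ := ‖(scaledDeriv f x).inverse‖ with hμ
  set b := μ * ‖evalSystem f x‖ with hb
  have hq0 : 0 ≤ q := Real.sqrt_nonneg _
  have hb0 : 0 ≤ b := by positivity
  have hδ : q ^ 3 * μ * b ≤ 1 / 8 := by
    calc q ^ 3 * μ * b = q ^ 3 * μ ^ 2 * ‖evalSystem f x‖ := by rw [hb]; ring
      _ ≤ _ := h
  have hDb : D * b ≤ 1 / 8 := (maxDegree_mul_le hqD hb0 hqμ).trans hδ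
  -- the Lipschitz constant exceeds `q ^ 3` by a factor at most `1 / (1 - 1 / 8) = 8 / 7`
  have hDR : D * (9 / 8 * b) ^ 2 / 2 ≤ 1 / 8 := by
    have : b ≤ 1 / 8 := by nlinarith
    nlinarith
  set F : perp x → EuclideanSpace ℝ (Fin n) := fun X => degScale d (affineRestriction f x X)
    with hFdef
  have hFdiff : Differentiable ℝ F := differentiable_degScale_affineRestriction f x
  have hF0 : fderiv ℝ F 0 = scaledDeriv f x := by
    rw [hFdef, fderiv_comp_left (differentiable_affineRestriction f x),
      fderiv_affineRestriction_zero f hx]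
  have hstep : ‖newton F 0 - 0‖ ≤ b := by
    have h1 : newton F 0 = newton (affineRestriction f x) 0 :=
      congrFun (newtonSeq_comp_left hS (differentiable_affineRestriction f x) 0) 1
    rw [h1, newton, zero_sub, sub_zero, norm_neg]
    exact hb1
  -- `L R ≤ 9 / 56 m` for `m = 1 / μ`
  have hLR : q ^ 3 * (8 / 7) * (9 / 8 * b) * μ ≤ 9 / 56 := by
    calc q ^ 3 * (8 / 7) * (9 / 8 * b) * μ = 9 / 7 * (q ^ 3 * μ * b) := by ring
      _ ≤ _ := by linarith
  have hLR' : q ^ 3 * (8 / 7) * (9 / 8 * b) ≤ 9 / 56 * μ⁻¹ := by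
    rwa [← div_eq_mul_inv, le_div_iff₀ hqμ2]
  have hμi : 0 < μ⁻¹ := inv_pos.mpr hqμ2
  obtain ⟨X, hX, hXR⟩ := newton_kantorovich (finrank_perp hx) hFdiff (X₀ := 0) (m := μ⁻¹)
    (L := q ^ 3 * (8 / 7)) (R := 9 / 8 * b) (q := 1 / 10) (by positivity) (by positivity)
    (by rw [hF0]; exact hlow)
    (fun X hX Y hY => hlip (9 / 8 * b) (by linarith)
      (by rw [div_le_iff₀ (by linarith)]; linarith) X Y
      (mem_closedBall_zero_iff.mp hX) (mem_closedBall_zero_iff.mp hY))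
    (by linarith)
    (by
      have hpos : 0 < μ⁻¹ - q ^ 3 * (8 / 7) * (9 / 8 * b) := by linarith
      rw [div_le_iff₀ (by linarith)]
      have h2 : q ^ 3 * (8 / 7) * ‖newton F 0 - 0‖ ≤ q ^ 3 * (8 / 7) * b := by gcongr
      have h3 : q ^ 3 * (8 / 7) * b ≤ 1 / 7 * μ⁻¹ := by
        rw [← div_eq_mul_inv, le_div_iff₀ hqμ2]
        calc q ^ 3 * (8 / 7) * b * μ = 8 / 7 * (q ^ 3 * μ * b) := by ring
          _ ≤ _ := by linarith
      linarith)
    (by norm_num)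
    (by rw [div_le_iff₀ (by norm_num)]; linarith)
  refine ⟨X, ?_, by simpa using hXR⟩
  exact (isApproxZeroSecondKind_comp_left hS (differentiable_affineRestriction f x)).mp hX

/-! ### Convergence from the neighbours of `x` -/

lemma zeta_eq {f : HomogSystem d} {z : EuclideanSpace ℝ (Fin (n + 1))} {X : perp z}
    (hX : Tendsto (newtonSeq (affineRestriction f z) 0) atTop (𝓝 X)) :
    zeta f z = ‖z + (X : EuclideanSpace ℝ (Fin (n + 1)))‖⁻¹ •
      (z + (X : EuclideanSpace ℝ (Fin (n + 1)))) := by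
  simp only [zeta, hX.limUnder_eq]

lemma one_sub_angle_sq_le_inner {V : Type*} [NormedAddCommGroup V] [InnerProductSpace ℝ V]
    {z ζ : V} (hz : ‖z‖ = 1) (hζ : ‖ζ‖ = 1) {θ : ℝ}
    (h : InnerProductGeometry.angle z ζ ≤ θ) : 1 - θ ^ 2 / 2 ≤ inner ℝ z ζ := by
  have h1 := InnerProductGeometry.cos_angle z ζ
  rw [hz, hζ, mul_one, div_one] at h1
  have h2 := Real.one_sub_sq_div_two_le_cos (x := InnerProductGeometry.angle z ζ)
  have h3 := pow_le_pow_left₀ (InnerProductGeometry.angle_nonneg z ζ) h 2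
  linarith

/-- If `ζ` is a zero within angle `9/8 b` of `x`, where `b = μ(f, x) ‖f(x)‖`, then the derivative
at `ζ` is bounded below by `(55 / 64) / μ(f, x)` on `x^⊥`. -/
lemma lower_bound_at_zero (hd : ∀ i, 1 ≤ d i) {f : HomogSystem d} (hf : systemNorm f = 1)
    {x ζ : EuclideanSpace ℝ (Fin (n + 1))} (hx : ‖x‖ = 1) (hζ : ‖ζ‖ = 1)
    (hI : (scaledDeriv f x).IsInvertible) (hμ : 0 < ‖(scaledDeriv f x).inverse‖) {b : ℝ}
    (hxζ : InnerProductGeometry.angle x ζ ≤ 9 / 8 * b)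
    (h : √(maxDegree d) ^ 3 * ‖(scaledDeriv f x).inverse‖ * b ≤ 1 / 8)
    (v : EuclideanSpace ℝ (Fin (n + 1))) (hv : inner ℝ x v = 0) :
    55 / 64 * ‖(scaledDeriv f x).inverse‖⁻¹ * ‖v‖ ≤ ‖fderiv ℝ (normalizedEval f) ζ v‖ := by
  have hlip := norm_fderiv_normalizedEval_sub_le hd f hf (ρ := 1) (B := 1) zero_le_one
    (fun i => (one_pow _).le) hx.le hζ.le
  have h1 : ‖(fderiv ℝ (normalizedEval f) ζ).comp (perp x).subtypeL - scaledDeriv f x‖ ≤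
      9 / 64 * ‖(scaledDeriv f x).inverse‖⁻¹ := by
    rw [scaledDeriv_eq f hx, ← ContinuousLinearMap.sub_comp, ← scaledDeriv_eq f hx]
    refine (ContinuousLinearMap.opNorm_comp_le _ _).trans
      ((mul_le_of_le_one_right (norm_nonneg _) (perp x).norm_subtypeL_le).trans (hlip.trans ?_))
    have h2 : ‖ζ - x‖ ≤ 9 / 8 * b := by
      rw [norm_sub_rev]; exact (norm_sub_le_angle hx hζ).trans hxζ
    rw [← div_eq_mul_inv, le_div_iff₀ hμ]
    calc √(maxDegree d) ^ 3 * 1 * ‖ζ - x‖ * ‖(scaledDeriv f x).inverse‖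
        ≤ √(maxDegree d) ^ 3 * 1 * (9 / 8 * b) * ‖(scaledDeriv f x).inverse‖ := by gcongr
      _ = 9 / 8 * (√(maxDegree d) ^ 3 * ‖(scaledDeriv f x).inverse‖ * b) := by ring
      _ ≤ _ := by linarith
  have h3 := lower_bound_of_norm_sub_le (scaledDeriv_lower_bound hI hμ) h1
    ⟨v, Submodule.mem_orthogonal_singleton_iff_inner_right.mpr hv⟩
  refine le_trans (le_of_eq ?_) h3
  rw [Submodule.coe_norm]
  ring

/-- Newton's method in the chart at `z` converges to the zero `ζ`, for all `z` close to `x`. The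
zero is represented by a point `X` with `‖X‖ ≤ 5/2 b`, where the derivative is bounded below by
`m = (4/5) / μ`; on the ball of radius `r = 5/2 b` around `X` it is Lipschitz with constant
`L = 5/4 (max d)^(3/2)`, and `L r / m < 2 / 3`. -/
lemma newtonConverges_of_mem (hd : ∀ i, 1 ≤ d i) {f : HomogSystem d} (hf : systemNorm f = 1)
    {x z ζ : EuclideanSpace ℝ (Fin (n + 1))} (hx : ‖x‖ = 1) (hz : ‖z‖ = 1) (hζ : ‖ζ‖ = 1)
    (hI : (scaledDeriv f x).IsInvertible) (hfζ : evalSystem f ζ = 0) {b : ℝ}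
    (hxζ : InnerProductGeometry.angle x ζ ≤ 9 / 8 * b)
    (hxz : InnerProductGeometry.angle x z ≤ 5 / 4 * b)
    (h : √(maxDegree d) ^ 3 * ‖(scaledDeriv f x).inverse‖ * b ≤ 1 / 8) :
    NewtonConverges (affineRestriction f z) 0 ∧ zeta f z = ζ := by
  have hqμ := one_le_sqrt_maxDegree_mul hd hf hx hI
  have hqD : √(maxDegree d) ^ 2 = (maxDegree d : ℝ) := Real.sq_sqrt (by positivity)
  have hμ := norm_inverse_pos hd hf hx hI
  have hDpos := one_le_maxDegree hd hf hx hI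
  have hb0 : 0 ≤ b := by
    have := (InnerProductGeometry.angle_nonneg x ζ).trans hxζ
    linarith
  have hlow := lower_bound_at_zero hd hf hx hζ hI hμ hxζ h
  have hDb : maxDegree d * b ≤ 1 / 8 := (maxDegree_mul_le hqD hb0 hqμ).trans h
  have hb1 : b ≤ 1 / 8 := by nlinarith
  have hzζ : InnerProductGeometry.angle z ζ ≤ 19 / 8 * b := by
    have := InnerProductGeometry.angle_le_angle_add_angle z x ζ
    rw [InnerProductGeometry.angle_comm z x] at this
    linarith
  set c := inner ℝ z ζ with hc
  have hc1 : 19 / 20 ≤ c := by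
    have := one_sub_angle_sq_le_inner hz hζ hzζ
    nlinarith
  have hxζ0 : inner ℝ x ζ ≠ 0 := by
    have := one_sub_angle_sq_le_inner hx hζ hxζ
    have : 0 < inner ℝ x ζ := by nlinarith
    exact this.ne'
  have hc2 : c ≤ 1 := by
    have := real_inner_le_norm z ζ
    rwa [hz, hζ, mul_one] at this
  have hc0 : 0 < c := by linarith
  -- the point of the chart at `z` that represents `ζ`
  have hmem : c⁻¹ • ζ - z ∈ perp z := by
    rw [Submodule.mem_orthogonal_singleton_iff_inner_right, inner_sub_right, inner_smul_right,
      ← hc, real_inner_self_eq_norm_sq, hz, inv_mul_cancel₀ hc0.ne']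
    norm_num
  obtain ⟨X, hzX⟩ : ∃ X : perp z, z + (X : EuclideanSpace ℝ (Fin (n + 1))) = c⁻¹ • ζ :=
    ⟨⟨c⁻¹ • ζ - z, hmem⟩, by simp⟩
  have hnX : ‖c⁻¹ • ζ‖ = c⁻¹ := by
    rw [norm_smul, hζ, mul_one, Real.norm_of_nonneg (inv_nonneg.mpr hc0.le)]
  -- `‖X‖` is the tangent of the angle between `z` and `ζ`
  have hXr : ‖X‖ ≤ 5 / 2 * b := by
    refine abs_le_of_sq_le_sq' ?_ (by positivity) |>.2
    have h1 := norm_add_perp_sq hz X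
    rw [hzX, hnX] at h1
    have h2 : 1 - (19 / 8 * b) ^ 2 / 2 ≤ c := one_sub_angle_sq_le_inner hz hζ hzζ
    have h3 : c ^ 2 * ‖X‖ ^ 2 = 1 - c ^ 2 := by
      have : ‖X‖ ^ 2 = c⁻¹ ^ 2 - 1 := by linarith
      rw [this]; field_simp
    have h4 : c ^ 2 * ‖X‖ ^ 2 ≤ (19 / 8 * b) ^ 2 := by
      rw [h3]; nlinarith
    have h5 : (19 / 20) ^ 2 * ‖X‖ ^ 2 ≤ c ^ 2 * ‖X‖ ^ 2 := by gcongr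
    nlinarith
  have hμi : 0 < ‖(scaledDeriv f x).inverse‖⁻¹ := inv_pos.mpr hμ
  have hS := degScale_isInvertible hd
  have hdiff := differentiable_affineRestriction f z
  have hDr : maxDegree d * (5 * b) ^ 2 / 2 ≤ 1 / 5 := by nlinarith
  have hXnorm : ∀ Y ∈ Metric.closedBall X (5 / 2 * b), ‖Y‖ ≤ 5 * b := by
    intro Y hY
    have h1 := mem_closedBall_iff_norm.mp hY
    have h2 := norm_le_norm_add_norm_sub X Y
    rw [norm_sub_rev] at h2
    linarith
  have hFX : affineRestriction f z X = 0 := by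
    rw [affineRestriction, hzX]
    exact evalSystem_smul_eq_zero f hfζ _
  have hlowX : ∀ v : perp z, 4 / 5 * ‖(scaledDeriv f x).inverse‖⁻¹ * ‖v‖ ≤
      ‖fderiv ℝ (fun X => degScale d (affineRestriction f z X)) X v‖ := by
    intro v
    rw [fderiv_degScale_affineRestriction, hzX, ContinuousLinearMap.comp_apply]
    refine le_trans ?_ (norm_fderiv_normalizedEval_le_smul hd f ((one_le_inv₀ hc0).mpr hc2) ζ _)
    refine le_trans ?_ (lower_bound_change_chart hz hζ (fderiv_normalizedEval_self f hfζ) hxζ0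
      (m := 55 / 64 * ‖(scaledDeriv f x).inverse‖⁻¹) (by positivity) hlow
      (w := (v : EuclideanSpace ℝ (Fin (n + 1))))
      (Submodule.mem_orthogonal_singleton_iff_inner_right.mp v.2))
    rw [← hc, ← Submodule.coe_norm]
    have : 4 / 5 * ‖(scaledDeriv f x).inverse‖⁻¹ ≤
        55 / 64 * ‖(scaledDeriv f x).inverse‖⁻¹ * c := by nlinarith
    gcongr
  obtain ⟨hwd, hlim⟩ := newton_tendsto_of_zero (finrank_perp hz)
    (differentiable_degScale_affineRestriction f z) (X := X) (X₀ := 0)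
    (m := 4 / 5 * ‖(scaledDeriv f x).inverse‖⁻¹) (L := √(maxDegree d) ^ 3 * (5 / 4))
    (r := 5 / 2 * b) (by positivity) (by rw [hFX, map_zero]) (by rwa [zero_sub, norm_neg]) hlowX
    (fun Y hY Z hZ => norm_fderiv_degScale_affineRestriction_sub_le hd f hf hz (t := 5 * b)
      (by linarith) (by rw [div_le_iff₀ (by linarith)]; linarith) (hXnorm Y hY) (hXnorm Z hZ))
    (by positivity)
    (by
      have : √(maxDegree d) ^ 3 * b ≤ 1 / 8 * ‖(scaledDeriv f x).inverse‖⁻¹ := by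
        rw [← div_eq_mul_inv, le_div_iff₀ hμ]
        linarith
      linarith)
  rw [newtonWellDefined_comp_left hS hdiff] at hwd
  rw [newtonSeq_comp_left hS hdiff] at hlim
  refine ⟨⟨hwd, X, hlim⟩, ?_⟩
  rw [zeta_eq hlim, hzX, hnX, smul_smul, inv_inv, mul_inv_cancel₀ hc0.ne', one_smul]

end Main

end Inclusion

open Inclusion in
theorem mainTheorem1 {n : ℕ} {d : Fin n → ℕ} (hd : ∀ i, 1 ≤ d i)
    (f : Inclusion.HomogSystem d) (hf : Inclusion.systemNorm f = 1)
    (x : EuclideanSpace ℝ (Fin (n + 1))) (hx : ‖x‖ = 1)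
    (hμ : Inclusion.condNumber f x ≠ ⊤)
    (h : ENNReal.ofReal ((Inclusion.maxDegree d : ℝ) ^ (3 / 2 : ℝ)) *
        Inclusion.condNumber f x ^ 2 * ENNReal.ofReal ‖Inclusion.evalSystem f x‖ ≤
      ENNReal.ofReal Inclusion.alphaStar) :
    Inclusion.alphaInv (Inclusion.affineRestriction f x) 0 ≤
      ENNReal.ofReal Inclusion.alphaStar ∧
    (∃ X : Inclusion.perp x,
      Inclusion.IsApproxZeroSecondKind (Inclusion.affineRestriction f x) X 0) ∧
    Inclusion.evalSystem f (Inclusion.zeta f x) = 0 ∧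
    Inclusion.zeta f x ∈ Inclusion.inclusionBall f x ∧
    ∀ z ∈ Inclusion.inclusionBall f x,
      Inclusion.NewtonConverges (Inclusion.affineRestriction f z) 0 ∧
      Inclusion.zeta f z = Inclusion.zeta f x := by
  have hI : (scaledDeriv f x).IsInvertible := by
    by_contra hI
    exact hμ (by rw [condNumber, if_neg hI])
  have hcond : condNumber f x = ENNReal.ofReal ‖(scaledDeriv f x).inverse‖ := by
    rw [condNumber, if_pos hI, hf, one_mul]
  have hpow : ((maxDegree d : ℝ)) ^ (3 / 2 : ℝ) = √(maxDegree d) ^ 3 := by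
    rw [Real.sqrt_eq_rpow, ← Real.rpow_natCast, ← Real.rpow_mul (by positivity)]
    norm_num
  have ha0 : 0 < alphaStar := alphaStar_mem.1
  rw [hcond, hpow, ← ENNReal.ofReal_pow (by positivity), ← ENNReal.ofReal_mul (by positivity),
    ← ENNReal.ofReal_mul (by positivity), ENNReal.ofReal_le_ofReal_iff ha0.le] at h
  obtain ⟨X, hX, hXb⟩ := exists_isApproxZeroSecondKind hd hf hx hI (h.trans alphaStar_le)
  set b := ‖(scaledDeriv f x).inverse‖ * ‖evalSystem f x‖ with hb
  have hb0 : 0 ≤ b := by positivity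
  have hball : ∀ y, y ∈ inclusionBall f x ↔
      ‖y‖ = 1 ∧ InnerProductGeometry.angle x y ≤ rZero alphaStar * b := by
    intro y
    have hr : 0 ≤ rZero alphaStar := le_trans (by norm_num) le_rZero_alphaStar
    simp only [inclusionBall, Set.mem_ofPred_eq]
    rw [hcond, ← ENNReal.ofReal_mul hr, ← ENNReal.ofReal_mul (by positivity),
      ENNReal.ofReal_le_ofReal_iff (by positivity), mul_assoc]
  have hzeta := zeta_eq hX.2.2.2
  have hnorm : 0 < ‖x + (X : EuclideanSpace ℝ (Fin (n + 1)))‖ := by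
    have := norm_add_perp_sq hx X
    by_contra! h0
    rw [le_antisymm h0 (norm_nonneg _)] at this
    nlinarith [sq_nonneg ‖X‖]
  have hzero : evalSystem f (zeta f x) = 0 := by
    rw [hzeta]
    exact evalSystem_smul_eq_zero f hX.1 _
  have hζ : ‖zeta f x‖ = 1 := by
    rw [hzeta, norm_smul, norm_inv, norm_norm, inv_mul_cancel₀ hnorm.ne']
  have hangle : InnerProductGeometry.angle x (zeta f x) ≤ 9 / 8 * b := by
    rw [hzeta, InnerProductGeometry.angle_smul_right_of_pos _ _ (inv_pos.mpr hnorm),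
      InnerProductGeometry.angle_add_eq_arctan_of_inner_eq_zero
        (Submodule.mem_orthogonal_singleton_iff_inner_right.mp X.2)
        (by rintro rfl; simp at hx), hx, div_one]
    have htan := Real.le_tan (Real.arctan_nonneg.mpr (norm_nonneg X)) (Real.arctan_lt_pi_div_two _)
    rw [Real.tan_arctan] at htan
    exact htan.trans hXb
  refine ⟨(alphaInv_affineRestriction_le hd hf hx hI).trans (ENNReal.ofReal_le_ofReal h),
    ⟨X, hX⟩, hzero, ?_, fun z hz => ?_⟩
  · rw [hball]
    refine ⟨hζ, hangle.trans ?_⟩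
    have := le_rZero_alphaStar
    gcongr
  · rw [hball] at hz
    refine newtonConverges_of_mem hd hf hx hz.1 hζ hI hzero hangle (hz.2.trans ?_) ?_
    · have := rZero_alphaStar_le
      gcongr
    · refine le_trans (le_of_eq ?_) (h.trans alphaStar_le)
      rw [hb]; ring
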